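/- **Setting (fractional paging with a convex objective).** Let $k\ge 1$ be the cache size and $\sigma=(p_1,\dots,p_T)$ a request sequence of pages from a set $P$. Let $r(p,t)$ be the number of requests to $p$ in rounds $1,\dots,t$, let $t(p,j)$ be the round of the $j$-th request to $p$, and let $B(t)=\{p: r(p,t)\ge1\}$. There is one variable $x_{p,j}$ for every round $t(p,j)$, so $x\in\mathbb R^T$. A vector $x$ is a *feasible fractional paging solution* if $0\le x_{p,j}\le 1$ for all $p,j$ and $$\sum_{p\in B(t)\setminus\{p_t\}}x_{p,r(p,t)}\ \ge\ |B(t)|-k\qquad\text{for all }t\in[T].$$ **Objectives.** Let $q\ge 1$ be real and let $f:\mathbb R_{\ge0}^T\to\mathbb R$ be convex and continuously differentiable (one-sidedly on the boundary) with: (1) $f(0)=0$; (2) $f$ is monotone, i.e. $x\le y$ implies $f(x)\le f(y)$; (3) every partial derivative of $f$ is monotone, i.e. $x\le y$ implies $\nabla f(x)\le\nabla f(y)$; (4) $\langle\nabla f(x),x\rangle\le q\,f(x)$ for all $x\ge 0$. Assume also that no partial derivative of $f$ vanishes identically on $\mathbb R^T_{\ge 0}$ (otherwise the rates $s_{p,j}$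 below are nowhere defined). **Algorithm.** A clock $\tau$ starts at $0$, and variables $x_{p,j},y_t,z_{p,j}$ start at $0$. In round $t$, as long as the constraint of round $t$ is violated, $\tau$ increases and the variables move continuously, with right derivatives $$\frac{dy_t}{d\tau}=r,\qquad \frac{dx_{p,r(p,t)}}{d\tau}=\begin{cases}s_{p,r(p,t)}(\tau)\left(x_{p,r(p,t)}+\frac1k\right)&\text{if }x_{p,r(p,t)}<1\\0&\text{otherwise}\end{cases},\qquad \frac{dz_{p,r(p,t)}}{d\tau}=\begin{cases}r&\text{if }x_{p,r(p,t)}=1\\0&\text{otherwise}\end{cases}$$ for all $p\in B(t)\setminus\{p_t\}$, while all other variables stay constant; the round ends as soon as its constraint holds. Here $$s_{p,j}(\tau)=\left(\frac{\partial f}{\partial x_{p,j}}(x(\tau))\right)^{-1},\qquad r=\frac1{\ln(k+1)\,(2q\ln(k+1))^{q-1}} .$$ The equations are required at all instants strictly inside the round, where the rates $s_{p,j}(\tau)$ in use must be finite and positive; a rate may be infinite at the instant at which the round begins. **Theorem.** (a) For all such $T,\sigma,f$ and every execution of the algorithm, the variables $x$ never decrease, the final value $\bar x$ is a feasible fractional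 paging solution, and $$f(\bar x)\ \le\ (2q\ln(k+1))^q\,f(x^*)\qquad\text{for every feasible fractional paging solution }x^* .$$ (b) The algorithm can be executed online: one can assign to all such $T,\sigma,f$ an execution of the algorithm (in particular every round ends after finite time) such that, for every $n\le T$, the execution during the first $n$ rounds (the clock values at the ends of these rounds and the variables belonging to these rounds) is the one assigned to the sequence of the first $n$ requests and to $f$ restricted to the first $n$ variables, all later variables being $0$. -/

import Mathlib

namespace Paging

/-! ### Request sequences and the convex program for fractional paging

A request sequence of length `T` is a map `σ : Fin T → P`. Every round `s` corresponds to exactly one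
pair `(p, j)`, namely `p = σ s` and `s` is the round of the `j`-th request to `p`. The variable
`x_{p,j}` is therefore written `x s`; this lists the variables in their order of appearance. -/

/-- `B(t)`: the set of distinct pages requested up to and including round `t`. -/
def seenPages {P : Type*} [DecidableEq P] {T : ℕ} (σ : Fin T → P) (t : Fin T) : Finset P :=
  (Finset.univ.filter (fun s : Fin T => s ≤ t)).image σ

/-- The variables `x_{p, r(p,t)}` with `p ∈ B(t) \ {p_t}`: the rounds `s < t` such that the page
requested in round `s` is not requested again in the rounds `s + 1, …, t`, in other words
`t ∈ [t(p,j) + 1, t(p,j+1) - 1]` when `s = t(p,j)`. -/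
def activeVars {P : Type*} [DecidableEq P] {T : ℕ} (σ : Fin T → P) (t : Fin T) :
    Finset (Fin T) :=
  Finset.univ.filter (fun s : Fin T => s < t ∧ ∀ u : Fin T, s < u → u ≤ t → σ u ≠ σ s)

/-- The constraint of round `t` for a cache of size `k`: `∑_{p ∈ B(t) \ {p_t}} x_{p,r(p,t)} ≥ |B(t)| - k`. -/
def Served {P : Type*} [DecidableEq P] {T : ℕ} (k : ℕ) (σ : Fin T → P) (x : Fin T → ℝ)
    (t : Fin T) : Prop :=
  ((seenPages σ t).card : ℝ) - (k : ℝ) ≤ ∑ s ∈ activeVars σ t, x s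

/-- Feasible points of the convex program for fractional paging. -/
def Feasible {P : Type*} [DecidableEq P] {T : ℕ} (k : ℕ) (σ : Fin T → P) (x : Fin T → ℝ) : Prop :=
  (∀ t, Served k σ x t) ∧ ∀ s, 0 ≤ x s ∧ x s ≤ 1

/-! ### Objective functions -/

/-- `∂f/∂x_i` at a point `x` of the nonnegative orthant (one-sided where `x_i = 0`). -/
noncomputable def partialDeriv {T : ℕ} (f : (Fin T → ℝ) → ℝ) (i : Fin T) (x : Fin T → ℝ) : ℝ :=
  fderivWithin ℝ f (Set.Ici 0) x (Pi.single i 1)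

/-- The class of objective functions, on the nonnegative orthant. -/
structure IsObjective {T : ℕ} (q : ℝ) (f : (Fin T → ℝ) → ℝ) : Prop where
  convex : ConvexOn ℝ (Set.Ici 0) f
  smooth : ContDiffOn ℝ 1 f (Set.Ici 0)
  zero : f 0 = 0
  mono : MonotoneOn f (Set.Ici 0)
  grad_mono : ∀ i, MonotoneOn (partialDeriv f i) (Set.Ici 0)
  growth : ∀ x, 0 ≤ x → ∑ i, partialDeriv f i x * x i ≤ q * f x
  /-- `f` depends on each variable; otherwise the reciprocal `(∂f/∂x_i)⁻¹` is nowhere defined. -/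
  nondegenerate : ∀ i, ∃ x, 0 ≤ x ∧ partialDeriv f i x ≠ 0

/-! ### The continuous-time primal-dual algorithm -/

/-- The record of an execution: `time t` is the value of the clock after `t` rounds (so round `t`,
counted from `0`, takes place between `time t.castSucc` and `time t.succ`), and `x τ`, `y τ`, `z τ`
are the values of the variables when the clock shows `τ`. -/
structure Execution (T : ℕ) where
  time : Fin (T + 1) → ℝ
  x : ℝ → Fin T → ℝ
  y : ℝ → Fin T → ℝ
  z : ℝ → Fin T → ℝ

/-- The value of the primal variables after all rounds. -/
def Execution.final {T : ℕ} (R : Execution T) : Fin T → ℝ := R.x (R.time (Fin.last T))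

/-- `R` is an execution of the primal-dual algorithm with parameters `r` and `s_{p,j}(τ)` on the
request sequence `σ` with cache size `k`. All variables are `0` initially (a variable that has
not been created yet is kept at `0`), they are continuous in the clock `τ`, and during a round they
solve the differential equations of the algorithm. The derivatives are right derivatives, because the
rates jump when some variable reaches `1`. The equations are imposed at every instant after the
beginning of the round; at the beginning itself they follow by continuity whenever the rates are
finite there, while a rate that is infinite at that single instant is allowed. -/
structure IsRun {P : Type*} [DecidableEq P] {T : ℕ} (k : ℕ) (σ : Fin T → P) (r : ℝ)
    (s : ℝ → Fin T → ℝ) (R : Execution T) : Prop where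
  time_zero : R.time 0 = 0
  time_le : ∀ t : Fin T, R.time t.castSucc ≤ R.time t.succ
  x_zero : R.x 0 = 0
  y_zero : R.y 0 = 0
  z_zero : R.z 0 = 0
  x_cont : ContinuousOn R.x (Set.Icc 0 (R.time (Fin.last T)))
  y_cont : ContinuousOn R.y (Set.Icc 0 (R.time (Fin.last T)))
  z_cont : ContinuousOn R.z (Set.Icc 0 (R.time (Fin.last T)))
  /-- The rates that are in use are positive. -/
  rate_pos : ∀ t : Fin T, ∀ τ ∈ Set.Ioo (R.time t.castSucc) (R.time t.succ),
    ∀ i ∈ activeVars σ t, R.x τ i < 1 → 0 < s τ i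
  y_deriv : ∀ t : Fin T, ∀ τ ∈ Set.Ioo (R.time t.castSucc) (R.time t.succ), ∀ i,
    HasDerivWithinAt (fun τ' => R.y τ' i) (if i = t then r else 0) (Set.Ici τ) τ
  x_deriv : ∀ t : Fin T, ∀ τ ∈ Set.Ioo (R.time t.castSucc) (R.time t.succ), ∀ i,
    HasDerivWithinAt (fun τ' => R.x τ' i)
      (if i ∈ activeVars σ t ∧ R.x τ i < 1 then s τ i * (R.x τ i + 1 / (k : ℝ)) else 0)
      (Set.Ici τ) τ
  z_deriv : ∀ t : Fin T, ∀ τ ∈ Set.Ioo (R.time t.castSucc) (R.time t.succ), ∀ i,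
    HasDerivWithinAt (fun τ' => R.z τ' i)
      (if i ∈ activeVars σ t ∧ R.x τ i = 1 then r else 0) (Set.Ici τ) τ
  /-- A round goes on as long as its constraint is violated … -/
  not_served : ∀ t : Fin T, ∀ τ ∈ Set.Ico (R.time t.castSucc) (R.time t.succ),
    ¬ Served k σ (R.x τ) t
  /-- … and ends as soon as its constraint holds. -/
  served : ∀ t : Fin T, Served k σ (R.x (R.time t.succ)) t

/-- The parameter `r = 1 / (ln(k+1) (2 q ln(k+1))^(q-1))`. -/
noncomputable def dualRate (k : ℕ) (q : ℝ) : ℝ :=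
  1 / (Real.log ((k : ℝ) + 1) * (2 * q * Real.log ((k : ℝ) + 1)) ^ (q - 1))

/-- `R` is an execution of the algorithm for the objective `f`, that is, with
`s_{p,j}(τ) = (∂f/∂x_{p,j})⁻¹` evaluated at `x(τ)` and `r = 1 / (ln(k+1) (2 q ln(k+1))^(q-1))`. -/
def IsObjectiveRun {P : Type*} [DecidableEq P] {T : ℕ} (k : ℕ) (q : ℝ) (σ : Fin T → P)
    (f : (Fin T → ℝ) → ℝ) (R : Execution T) : Prop :=
  IsRun k σ (dualRate k q) (fun τ i => (partialDeriv f i (R.x τ))⁻¹) R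

/-! ### Online executions -/

/-- The first `n` requests. -/
def prefixSeq {P : Type*} {n T : ℕ} (h : n ≤ T) (σ : Fin T → P) : Fin n → P :=
  fun i => σ (Fin.castLE h i)

/-- The objective as a function of the first `n` variables, all later ones being `0`. -/
def prefixObj {n T : ℕ} (_h : n ≤ T) (f : (Fin T → ℝ) → ℝ) : (Fin n → ℝ) → ℝ :=
  fun x => f (fun i => if hi : i.1 < n then x ⟨i.1, hi⟩ else 0)

/-- `R'` coincides with `R` during the first `n` rounds, for the variables of these rounds. -/
def Extends {n T : ℕ} (h : n ≤ T) (R' : Execution T) (R : Execution n) : Prop :=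
  (∀ m : Fin (n + 1), R'.time (Fin.castLE (Nat.succ_le_succ h) m) = R.time m) ∧
  ∀ τ ∈ Set.Icc 0 (R.time (Fin.last n)), ∀ i : Fin n,
    R'.x τ (Fin.castLE h i) = R.x τ i ∧ R'.y τ (Fin.castLE h i) = R.y τ i ∧
      R'.z τ (Fin.castLE h i) = R.z τ i

end Paging

namespace Paging

open Set Filter Topology

/-! ### Calculus on the nonnegative orthant -/

section Calculus

variable {T : ℕ} {f : (Fin T → ℝ) → ℝ}

/-! Competitive ratio. Let x̄ be the final point and y a feasible solution, and compare f(x(τ)) with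
2 ∑ ∂ᵢf(x̄) yᵢ log(1 + k xᵢ(τ)). The rates 1/∂ᵢf make f grow at speed ∑ (xᵢ + 1/k) over the active
variables below 1, and while the constraint is violated counting bounds this by 2 ∑ yᵢ
(`sum_add_inv_le_two_mul_sum`). Meanwhile log(1 + k xᵢ) grows at speed exactly 1/∂ᵢf(x(τ)) ≥
1/∂ᵢf(x̄), since x increases and the gradient is monotone. Hence f(x̄) ≤ 2 ln(k+1) ⟨∇f(x̄), y⟩
(`IsObjectiveRun.le_two_mul_log_mul_inner`). With L = 2q ln(k+1), the tangent at x̄ evaluated at L y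
together with ⟨∇f(x̄), x̄⟩ ≤ q f(x̄) gives f(x̄) ≤ f(L y), and the growth condition gives f(L y) ≤
L^q f(y).

Existence. The right-hand side of the differential equation is only continuous, and it is infinite
where ∂ᵢf = 0, which can happen when a round begins. So a Peano-type discretisation is used whose
steps are measured by the growth of f along each coordinate instead of by a speed (`IsStep`).
Comparison with f on the coordinate axes gives a modulus of continuity independent of the step size,
and a linear lower bound makes active variables positive at once, hence their partial derivatives
positive. A limit along an ultrafilter is then a flow (`IsObjective.exists_isFlow`). It drives all
active variables to 1, so the round ends in finite time; gluing rounds one at a time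
(`IsObjectiveRun.exists_extends`) and recursing on the number of requests gives the online
algorithm. -/

lemma uniqueDiffOn_orthant (T : ℕ) : UniqueDiffOn ℝ (Ici (0 : Fin T → ℝ)) := by
  rw [← pi_univ_Ici]
  exact UniqueDiffOn.univ_pi fun i => uniqueDiffOn_Ici _

lemma fderivWithin_eq_sum_partialDeriv (f : (Fin T → ℝ) → ℝ) (x v : Fin T → ℝ) :
    fderivWithin ℝ f (Ici 0) x v = ∑ i, partialDeriv f i x * v i := by
  have h := (fderivWithin ℝ f (Ici 0) x).toLinearMap.pi_apply_eq_sum_univ v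
  simp only [ContinuousLinearMap.coe_coe] at h
  rw [h]
  refine Finset.sum_congr rfl fun i _ => ?_
  have : (fun j => if i = j then (1 : ℝ) else 0) = Pi.single i 1 := by
    ext j; simp [Pi.single_apply, eq_comm]
  rw [this, smul_eq_mul, mul_comm, partialDeriv]

lemma hasDerivWithinAt_comp_curve (hf : DifferentiableOn ℝ f (Ici 0)) {γ : ℝ → Fin T → ℝ}
    {γ' : Fin T → ℝ} {s : Set ℝ} {τ : ℝ} (hτ : τ ∈ s) (hs : MapsTo γ s (Ici 0))
    (hγ : ∀ i, HasDerivWithinAt (fun u => γ u i) (γ' i) s τ) :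
    HasDerivWithinAt (fun u => f (γ u)) (∑ i, partialDeriv f i (γ τ) * γ' i) s τ := by
  rw [← fderivWithin_eq_sum_partialDeriv]
  exact ((hf _ (hs hτ)).hasFDerivWithinAt).comp_hasDerivWithinAt τ
    (hasDerivWithinAt_pi.2 hγ) hs

lemma continuousOn_partialDeriv (hf : ContDiffOn ℝ 1 f (Ici 0)) (i : Fin T) :
    ContinuousOn (partialDeriv f i) (Ici 0) :=
  (hf.continuousOn_fderivWithin (uniqueDiffOn_orthant T) le_rfl).clm_apply continuousOn_const

end Calculus

/-! ### Consequences of convexity, gradient monotonicity and growth -/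

namespace IsObjective

variable {T : ℕ} {q : ℝ} {f : (Fin T → ℝ) → ℝ}

lemma differentiableOn (hf : IsObjective q f) : DifferentiableOn ℝ f (Ici 0) :=
  hf.smooth.differentiableOn one_ne_zero

lemma hasDerivWithinAt_line (hf : IsObjective q f) {x v : Fin T → ℝ} {s : Set ℝ} {u : ℝ}
    (hu : u ∈ s) (hs : ∀ u ∈ s, 0 ≤ x + u • v) :
    HasDerivWithinAt (fun u : ℝ => f (x + u • v)) (∑ i, partialDeriv f i (x + u • v) * v i) s u := by
  refine hasDerivWithinAt_comp_curve hf.differentiableOn (γ := fun u => x + u • v) hu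
    (fun u hu => hs u hu) fun i => ?_
  simpa using (((hasDerivAt_id u).mul_const (v i)).const_add (x i)).hasDerivWithinAt

lemma gradient_le (hf : IsObjective q f) {x y : Fin T → ℝ} (hx : 0 ≤ x) (hy : 0 ≤ y) :
    ∑ i, partialDeriv f i x * (y i - x i) ≤ f y - f x := by
  have hmem : ∀ u ∈ Icc (0 : ℝ) 1, 0 ≤ x + u • (y - x) := fun u hu => by
    have : x + u • (y - x) = (1 - u) • x + u • y := by ext i; simp; ring
    rw [this]
    exact add_nonneg (smul_nonneg (by linarith [hu.2]) hx) (smul_nonneg hu.1 hy)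
  have hconv : ConvexOn ℝ (Icc (0 : ℝ) 1) fun u => f (x + u • (y - x)) := by
    refine ⟨convex_Icc 0 1, fun u hu w hw a b ha hb hab => ?_⟩
    have := hf.convex.2 (hmem u hu) (hmem w hw) ha hb hab
    refine le_trans (le_of_eq (congrArg f ?_)) this
    ext i
    simp only [Pi.add_apply, Pi.smul_apply, smul_eq_mul, Pi.sub_apply]
    linear_combination (-x i) * hab
  have h := hconv.le_slope_of_hasDerivWithinAt (left_mem_Icc.2 zero_le_one)
    (right_mem_Icc.2 zero_le_one) zero_lt_one
    (hf.hasDerivWithinAt_line (left_mem_Icc.2 zero_le_one) hmem)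
  simpa [slope_def_field] using h

lemma nonneg (hf : IsObjective q f) {x : Fin T → ℝ} (hx : 0 ≤ x) : 0 ≤ f x := by
  have := hf.mono (mem_Ici.2 le_rfl) (mem_Ici.2 hx) hx
  rwa [hf.zero] at this

lemma partialDeriv_nonneg (hf : IsObjective q f) {x : Fin T → ℝ} (hx : 0 ≤ x) (i : Fin T) :
    0 ≤ partialDeriv f i x := by
  have hmem : ∀ u ∈ Ici (0 : ℝ), 0 ≤ x + u • (Pi.single i 1 : Fin T → ℝ) := fun u hu =>
    add_nonneg hx (smul_nonneg hu (Pi.single_nonneg.2 zero_le_one))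
  have h := hf.hasDerivWithinAt_line (u := 0) self_mem_Ici hmem
  have hm : MonotoneOn (fun u : ℝ => f (x + u • (Pi.single i 1 : Fin T → ℝ))) (Ici 0) :=
    fun u hu w hw huw => hf.mono (hmem u hu) (hmem w hw) (by
      gcongr
      exact Pi.single_nonneg.2 zero_le_one)
  have h2 := hm.derivWithin_nonneg (x := 0)
  rw [h.derivWithin (uniqueDiffOn_Ici 0 0 self_mem_Ici)] at h2
  simpa [Pi.single_apply] using h2

/-- Both increments have derivative ⟨∇f, v⟩ along v, taken at ordered points, so gradient
monotonicity orders them. This later allows increments of f to be compared with increments on a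
coordinate axis. -/
lemma increment_mono (hf : IsObjective q f) {x x' v : Fin T → ℝ} (hx : 0 ≤ x) (hxx' : x ≤ x')
    (hv : 0 ≤ v) : f (x + v) - f x ≤ f (x' + v) - f x' := by
  have hmem : ∀ y : Fin T → ℝ, 0 ≤ y → ∀ u ∈ Icc (0 : ℝ) 1, 0 ≤ y + u • v := fun y hy u hu =>
    add_nonneg hy (smul_nonneg hu.1 hv)
  have hx' : 0 ≤ x' := hx.trans hxx'
  have hd : ∀ u ∈ Icc (0 : ℝ) 1,
      HasDerivWithinAt (fun u : ℝ => f (x' + u • v) - f (x + u • v)) _ (Icc 0 1) u :=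
    fun u hu => (hf.hasDerivWithinAt_line hu (hmem x' hx')).sub
      (hf.hasDerivWithinAt_line hu (hmem x hx))
  have hm : MonotoneOn (fun u : ℝ => f (x' + u • v) - f (x + u • v)) (Icc 0 1) := by
    refine monotoneOn_of_hasDerivWithinAt_nonneg (convex_Icc 0 1)
      (fun u hu => (hd u hu).continuousWithinAt)
      (fun u hu => (hd u (interior_subset hu)).mono interior_subset) fun u hu => ?_
    have hu' := interior_subset hu
    rw [← Finset.sum_sub_distrib]
    refine Finset.sum_nonneg fun i _ => ?_
    rw [← sub_mul]
    exact mul_nonneg (sub_nonneg.2 (hf.grad_mono i (hmem x hx u hu') (hmem x' hx' u hu')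
      (add_le_add_left hxx' _))) (hv i)
  have := hm (left_mem_Icc.2 zero_le_one) (right_mem_Icc.2 zero_le_one) zero_le_one
  simp only [zero_smul, add_zero, one_smul] at this
  linarith

/-- The growth condition bounds the decrease of `f` along a ray. -/
lemma rpow_mul_le (hf : IsObjective q f) {x : Fin T → ℝ} (hx : 0 ≤ x) {c : ℝ}
    (hc : 0 < c) (hc1 : c ≤ 1) : c ^ q * f x ≤ f (c • x) := by
  have hmem : ∀ u ∈ Icc c 1, 0 ≤ 0 + u • x := fun u hu => by
    simpa using smul_nonneg (hc.le.trans hu.1) hx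
  have hpos : ∀ u ∈ Icc c 1, 0 < u := fun u hu => hc.trans_le hu.1
  -- The quotient f(ux)/u^q is antitone: its derivative is u^(-q-1) (⟨∇f(ux), ux⟩ - q f(ux)).
  have hd : ∀ u ∈ Icc c 1, HasDerivWithinAt (fun u : ℝ => f (0 + u • x) * u ^ (-q)) _ (Icc c 1) u :=
    fun u hu => (hf.hasDerivWithinAt_line hu hmem).mul
      ((Real.hasDerivAt_rpow_const (p := -q) (Or.inl (hpos u hu).ne')).hasDerivWithinAt)
  have hm : AntitoneOn (fun u : ℝ => f (0 + u • x) * u ^ (-q)) (Icc c 1) := by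
    refine antitoneOn_of_hasDerivWithinAt_nonpos (convex_Icc c 1)
      (fun u hu => (hd u hu).continuousWithinAt)
      (fun u hu => (hd u (interior_subset hu)).mono interior_subset) fun u hu => ?_
    have hu' := interior_subset hu
    have hu0 := hpos u hu'
    have hg := hf.growth _ (hmem u hu')
    have hr : u ^ (-q) = u * u ^ (-q - 1) := by
      rw [Real.rpow_sub_one hu0.ne']; field_simp
    have he : (∑ i, partialDeriv f i (0 + u • x) * (0 + u • x) i)
        = u * ∑ i, partialDeriv f i (0 + u • x) * x i := by
      rw [Finset.mul_sum]
      exact Finset.sum_congr rfl fun i _ => by simp; ring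
    rw [he] at hg
    have hp : 0 ≤ u ^ (-q - 1) := by positivity
    rw [hr]
    nlinarith [mul_le_mul_of_nonneg_right hg hp]
  have := hm (left_mem_Icc.2 hc1) (right_mem_Icc.2 hc1) hc1
  simp only [one_smul, zero_add, Real.one_rpow, mul_one, Real.rpow_neg hc.le] at this
  rw [← div_eq_mul_inv, le_div_iff₀ (by positivity)] at this
  linarith

/-- Where ∂ᵢf is positive, the tangent plane is positive far out on the i-th axis, hence so is f;
the growth condition carries positivity back towards the origin. -/
lemma single_pos (hf : IsObjective q f) (i : Fin T) {a : ℝ} (ha : 0 < a) :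
    0 < f (Pi.single i a) := by
  obtain ⟨x, hx, hne⟩ := hf.nondegenerate i
  have hD : 0 < partialDeriv f i x := lt_of_le_of_ne (hf.partialDeriv_nonneg hx i) hne.symm
  -- Chosen so that ∂ᵢf(x) b exceeds ⟨∇f(x), x⟩ and b ≥ a, which makes the tangent at x positive at
  -- b eᵢ.
  obtain ⟨b, hb⟩ : ∃ b, b = a + (∑ j, partialDeriv f j x * x j + 1) / partialDeriv f i x := ⟨_, rfl⟩
  have hS : 0 ≤ ∑ j, partialDeriv f j x * x j :=
    Finset.sum_nonneg fun j _ => mul_nonneg (hf.partialDeriv_nonneg hx j) (hx j)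
  have hab : a ≤ b := by rw [hb]; linarith [div_nonneg (add_nonneg hS zero_le_one) hD.le]
  have hb0 : 0 < b := ha.trans_le hab
  have hbs : 0 ≤ (Pi.single i b : Fin T → ℝ) := Pi.single_nonneg.2 hb0.le
  have hfb : 0 < f (Pi.single i b) := by
    have h := hf.gradient_le hx hbs
    simp only [mul_sub, Finset.sum_sub_distrib] at h
    rw [Finset.sum_eq_single i (fun j _ hj => by simp [hj]) (by simp)] at h
    have : partialDeriv f i x * b
        = partialDeriv f i x * a + (∑ j, partialDeriv f j x * x j + 1) := by
      rw [hb]; field_simp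
    simp only [Pi.single_eq_same] at h
    nlinarith [hf.nonneg hx, mul_pos hD ha]
  have h := hf.rpow_mul_le hbs (div_pos ha hb0) ((div_le_one hb0).2 hab)
  rw [← Pi.single_smul, smul_eq_mul, div_mul_cancel₀ _ hb0.ne'] at h
  exact (mul_pos (by positivity) hfb).trans_le h

/-- On the i-th axis convexity gives ∂ᵢf(xᵢ eᵢ) xᵢ ≥ f(xᵢ eᵢ) > 0, and xᵢ eᵢ ≤ x. Thus a rate can be
infinite only while its variable is 0. -/
lemma partialDeriv_pos (hf : IsObjective q f) {x : Fin T → ℝ} (hx : 0 ≤ x) {i : Fin T}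
    (hi : 0 < x i) : 0 < partialDeriv f i x := by
  have hs : 0 ≤ (Pi.single i (x i) : Fin T → ℝ) := Pi.single_nonneg.2 hi.le
  have h := hf.gradient_le hs le_rfl
  rw [Finset.sum_eq_single i (fun j _ hj => by simp [hj]) (by simp), hf.zero] at h
  simp only [Pi.single_eq_same, Pi.zero_apply] at h
  have h1 := hf.single_pos i hi
  have h2 : 0 < partialDeriv f i (Pi.single i (x i)) := by
    by_contra hneg
    nlinarith [not_lt.1 hneg]
  refine h2.trans_le (hf.grad_mono i hs hx fun j => ?_)
  rcases eq_or_ne j i with rfl | hj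
  · simp
  · simpa [hj] using hx j

end IsObjective

/-! ### Fencing with right derivatives on an open interval -/

/-- A slowly rising line is a barrier for g. Nothing is known about the derivative at a, so the
barrier starts at a point c just after a, where continuity keeps g small. The sign of g' matters
only on the strip 0 < g < δ. -/
lemma nonpos_of_rightDeriv_nonpos {g g' : ℝ → ℝ} {a b δ : ℝ} (hδ : 0 < δ)
    (hg : ContinuousOn g (Icc a b)) (ha : g a ≤ 0)
    (hd : ∀ τ ∈ Ioo a b, HasDerivWithinAt g (g' τ) (Ici τ) τ)
    (hle : ∀ τ ∈ Ioo a b, 0 < g τ → g τ < δ → g' τ ≤ 0) : ∀ τ ∈ Icc a b, g τ ≤ 0 := by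
  intro x hx
  by_contra! hpos
  have hax : a < x := lt_of_le_of_ne hx.1 (by rintro rfl; linarith)
  have hab : 0 < 1 + b - a := by linarith [hx.2]
  -- With this slope the barrier η + η(τ - c) stays in (0, δ) and ends below g x.
  obtain ⟨η, hη⟩ : ∃ η, η = min δ (g x) / (2 * (1 + b - a)) := ⟨_, rfl⟩
  have hm : 0 < min δ (g x) := lt_min hδ hpos
  have hη0 : 0 < η := by rw [hη]; positivity
  have hηm : η * (1 + b - a) = min δ (g x) / 2 := by rw [hη]; field_simp
  obtain ⟨c, hc, hcη⟩ : ∃ c ∈ Ioo a x, g c < η := by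
    have h1 : ∀ᶠ c in 𝓝[>] a, g c < η := by
      have hcont := (hg a ⟨le_rfl, hx.1.trans hx.2⟩).mono_of_mem_nhdsWithin
        (t := Icc a b) (s := Ioi a) (Icc_mem_nhdsGT (hax.trans_le hx.2))
      exact hcont.eventually (gt_mem_nhds (ha.trans_lt hη0))
    obtain ⟨c, hc1, hc2⟩ := (h1.and (Ioo_mem_nhdsGT hax)).exists
    exact ⟨c, hc2, hc1⟩
  have hB : ∀ τ, HasDerivAt (fun τ => η + η * (τ - c)) η τ := fun τ => by
    simpa using (((hasDerivAt_id τ).sub_const c).const_mul η).const_add η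
  have hsub : ∀ τ ∈ Ico c x, τ ∈ Ioo a b := fun τ hτ =>
    ⟨hc.1.trans_le hτ.1, hτ.2.trans_le hx.2⟩
  have := image_le_of_deriv_right_lt_deriv_boundary (f' := g')
    (hg.mono (Icc_subset_Icc hc.1.le hx.2)) (fun τ hτ => hd τ (hsub τ hτ)) (by simpa using hcη.le)
    hB (fun τ hτ hτB => by
      refine (hle τ (hsub τ hτ) ?_ ?_).trans_lt hη0
      · rw [hτB]; nlinarith [hτ.1]
      · have h1 : η * (τ - c) ≤ η * (b - a) :=
          mul_le_mul_of_nonneg_left (by linarith [hτ.2, hx.2, hc.1]) hη0.le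
        rw [hτB]
        linarith [min_le_left δ (g x)]) (right_mem_Icc.2 hc.2.le)
  have h1 : η * (x - c) ≤ η * (b - a) :=
    mul_le_mul_of_nonneg_left (by linarith [hx.2, hc.1]) hη0.le
  linarith [min_le_right δ (g x)]

lemma antitoneOn_of_rightDeriv_nonpos {g g' : ℝ → ℝ} {a b : ℝ} (hg : ContinuousOn g (Icc a b))
    (hd : ∀ τ ∈ Ioo a b, HasDerivWithinAt g (g' τ) (Ici τ) τ)
    (hle : ∀ τ ∈ Ioo a b, g' τ ≤ 0) : AntitoneOn g (Icc a b) := by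
  intro u hu w hw huw
  have hsub : ∀ τ ∈ Ioo u b, τ ∈ Ioo a b := fun τ hτ => ⟨hu.1.trans_lt hτ.1, hτ.2⟩
  have := nonpos_of_rightDeriv_nonpos (g := fun τ => g τ - g u) zero_lt_one
    ((hg.mono (Icc_subset_Icc_left hu.1)).sub continuousOn_const) (sub_self _).le
    (fun τ hτ => (hd τ (hsub τ hτ)).sub_const _) (fun τ hτ _ _ => hle τ (hsub τ hτ)) w ⟨huw, hw.2⟩
  linarith

/-! ### Combinatorics of request sequences -/

section Requests

variable {P : Type*} [DecidableEq P] {T : ℕ}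

lemma notMem_activeVars_self (σ : Fin T → P) (t : Fin T) : t ∉ activeVars σ t := by
  simp [activeVars]

/-- Each page seen so far is represented by the round of its latest request: this is t for the
current page and an active variable for every other page. -/
lemma card_seenPages (σ : Fin T → P) (t : Fin T) :
    (seenPages σ t).card = (activeVars σ t).card + 1 := by
  rw [← Finset.card_insert_of_notMem (notMem_activeVars_self σ t),
    ← Finset.card_image_of_injOn (s := insert t (activeVars σ t)) (f := σ)]
  · congr 1
    ext p
    simp only [seenPages, activeVars, Finset.mem_image, Finset.mem_filter, Finset.mem_univ,
      true_and, Finset.mem_insert]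
    constructor
    · rintro ⟨s, hs, rfl⟩
      have hne : (Finset.univ.filter fun u => u ≤ t ∧ σ u = σ s).Nonempty := ⟨s, by simp [hs]⟩
      obtain ⟨u, hu, hmax⟩ := Finset.exists_max_image _ id hne
      simp only [Finset.mem_filter, Finset.mem_univ, true_and, id] at hu hmax
      refine ⟨u, ?_, hu.2⟩
      rcases hu.1.eq_or_lt with h | h
      · exact Or.inl h
      · refine Or.inr ⟨h, fun w hw hwt hσ => ?_⟩
        exact absurd (hmax w ⟨hwt, hσ.trans hu.2⟩) (not_le.2 hw)
    · rintro ⟨s, rfl | hs, rfl⟩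
      · exact ⟨s, le_rfl, rfl⟩
      · exact ⟨s, hs.1.le, rfl⟩
  · have key : ∀ a ∈ insert t (activeVars σ t), ∀ b ∈ insert t (activeVars σ t),
        σ a = σ b → ¬ a < b := by
      intro a ha b hb hab hlt
      have hbt : b ≤ t := by
        rcases Finset.mem_insert.1 hb with rfl | hb
        · exact le_rfl
        · exact (Finset.mem_filter.1 hb).2.1.le
      rcases Finset.mem_insert.1 ha with rfl | ha
      · exact absurd hlt (not_lt.2 hbt)
      · exact (Finset.mem_filter.1 ha).2.2 b hlt hbt hab.symm
    intro a ha b hb hab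
    exact le_antisymm (not_lt.1 (key b hb a ha hab.symm)) (not_lt.1 (key a ha b hb hab))

/-- While the constraint of round `t` is violated, the increase of the objective is at most twice
what any feasible solution pays on the variables that are still below `1`. -/
lemma sum_add_inv_le_two_mul_sum {k : ℕ} (hk : 1 ≤ k) {σ : Fin T → P} {t : Fin T}
    {x y : Fin T → ℝ} (hx0 : ∀ i, 0 ≤ x i) (hx1 : ∀ i, x i ≤ 1) (hx : ¬ Served k σ x t)
    (hy1 : ∀ i, y i ≤ 1) (hy : Served k σ y t) :
    ∑ i ∈ (activeVars σ t).filter (x · < 1), (x i + 1 / (k : ℝ))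
      ≤ 2 * ∑ i ∈ (activeVars σ t).filter (x · < 1), y i := by
  obtain ⟨N, hN⟩ : ∃ N, N = (activeVars σ t).filter (x · < 1) := ⟨_, rfl⟩
  obtain ⟨M, hM⟩ : ∃ M, M = (activeVars σ t).filter (¬ x · < 1) := ⟨_, rfl⟩
  have hcard : N.card + M.card = (activeVars σ t).card := by
    rw [hN, hM]; exact Finset.card_filter_add_card_filter_not _
  have hsum : ∀ u : Fin T → ℝ, ∑ i ∈ activeVars σ t, u i = ∑ i ∈ N, u i + ∑ i ∈ M, u i :=
    fun u => by rw [hN, hM]; exact (Finset.sum_filter_add_sum_filter_not _ _ _).symm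
  rw [Served, hsum, card_seenPages, ← hcard] at hx hy
  push_cast at hx hy
  have hxM : ∑ i ∈ M, x i = M.card := by
    rw [Finset.card_eq_sum_ones]
    push_cast
    refine Finset.sum_congr rfl fun i hi => le_antisymm (hx1 i) ?_
    rw [hM] at hi
    exact not_lt.1 (Finset.mem_filter.1 hi).2
  have hyM : ∑ i ∈ M, y i ≤ M.card := by
    rw [Finset.card_eq_sum_ones]
    push_cast
    exact Finset.sum_le_sum fun i _ => hy1 i
  have hxN : 0 ≤ ∑ i ∈ N, x i := Finset.sum_nonneg fun i _ => hx0 i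
  have hk' : (1 : ℝ) ≤ k := by exact_mod_cast hk
  -- Violation reads ∑ x over N < |N| + 1 - k, the entries over M being exactly 1; the left side is
  -- nonnegative, so |N| ≥ k by integrality.
  have hm : (k : ℝ) ≤ N.card := by
    have : (k : ℝ) < N.card + 1 := by linarith
    exact_mod_cast Nat.lt_succ_iff.1 (by exact_mod_cast this)
  -- Equivalent to (k - 1)(|N| - k) ≥ 0. Thus ∑ x and |N|/k over N are each at most |N| + 1 - k,
  -- which ∑ y over N is at least.
  have hdiv : (N.card : ℝ) * (1 / k) ≤ N.card + 1 - k := by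
    rw [mul_one_div, div_le_iff₀ (by linarith)]
    nlinarith
  rw [← hN, Finset.sum_add_distrib, Finset.sum_const, nsmul_eq_mul]
  linarith

end Requests

/-! ### Invariants of an execution -/

namespace IsRun

variable {P : Type*} [DecidableEq P] {T : ℕ} {k : ℕ} {σ : Fin T → P} {r : ℝ}
  {s : ℝ → Fin T → ℝ} {R : Execution T}

lemma monotone_time (hR : IsRun k σ r s R) : Monotone R.time :=
  Fin.monotone_iff_le_succ.2 hR.time_le

lemma time_nonneg (hR : IsRun k σ r s R) (m : Fin (T + 1)) : 0 ≤ R.time m :=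
  hR.time_zero ▸ hR.monotone_time (Fin.zero_le m)

lemma round_subset (hR : IsRun k σ r s R) (t : Fin T) :
    Icc (R.time t.castSucc) (R.time t.succ) ⊆ Icc 0 (R.time (Fin.last T)) :=
  Icc_subset_Icc (hR.time_nonneg _) (hR.monotone_time (Fin.le_last _))

lemma continuousOn_round (hR : IsRun k σ r s R) (t : Fin T) (i : Fin T) :
    ContinuousOn (fun τ => R.x τ i) (Icc (R.time t.castSucc) (R.time t.succ)) :=
  (continuousOn_pi.1 hR.x_cont i).mono (hR.round_subset t)

lemma antitoneOn_of_rounds (hR : IsRun k σ r s R) {g : ℝ → ℝ}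
    (hg : ∀ t : Fin T, AntitoneOn g (Icc (R.time t.castSucc) (R.time t.succ))) :
    AntitoneOn g (Icc 0 (R.time (Fin.last T))) := by
  suffices ∀ m : Fin (T + 1), AntitoneOn g (Icc 0 (R.time m)) from this _
  intro m
  induction m using Fin.induction with
  | zero =>
    rw [hR.time_zero, Icc_self]
    exact (subsingleton_singleton).antitoneOn g
  | succ t ih =>
    rw [← Icc_union_Icc_eq_Icc (hR.time_nonneg t.castSucc) (hR.time_le t)]
    exact ih.union_right (hg t) (isGreatest_Icc (hR.time_nonneg _)) (isLeast_Icc (hR.time_le t))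

lemma x_mem_Icc (hR : IsRun k σ r s R) (hk : 1 ≤ k) {τ : ℝ}
    (hτ : τ ∈ Icc 0 (R.time (Fin.last T))) (i : Fin T) : R.x τ i ∈ Icc (0 : ℝ) 1 := by
  suffices ∀ m : Fin (T + 1), ∀ τ ∈ Icc 0 (R.time m), R.x τ i ∈ Icc (0 : ℝ) 1 from this _ τ hτ
  have hk' : (0 : ℝ) < 1 / k := by positivity
  intro m
  induction m using Fin.induction with
  | zero =>
    intro τ hτ
    rw [hR.time_zero, Icc_self, mem_singleton_iff] at hτ
    rw [hτ, hR.x_zero]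
    simp
  | succ t ih =>
    intro τ hτ
    rw [← Icc_union_Icc_eq_Icc (hR.time_nonneg t.castSucc) (hR.time_le t)] at hτ
    rcases hτ with hτ | hτ
    · exact ih τ hτ
    have h0 := ih _ (right_mem_Icc.2 (hR.time_nonneg t.castSucc))
    have hc := hR.continuousOn_round t i
    constructor
    -- The strip has width 1/k because the speed s (x + 1/k) is known to be nonnegative only for x >
    -- -1/k.
    · have := nonpos_of_rightDeriv_nonpos hk' hc.neg (neg_nonpos.2 h0.1)
        (fun τ hτ => (hR.x_deriv t τ hτ i).neg) (fun τ hτ h1 h2 => by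
          split_ifs with h
          · have := hR.rate_pos t τ hτ i h.1 h.2
            have h3 : 0 < R.x τ i + 1 / (k : ℝ) := by
              simp only [Pi.neg_apply] at h2
              linarith
            exact neg_nonpos.2 (mul_nonneg this.le h3.le)
          · simp) τ hτ
      simpa using this
    · have := nonpos_of_rightDeriv_nonpos zero_lt_one (hc.sub continuousOn_const)
        (sub_nonpos.2 h0.2) (fun τ hτ => (hR.x_deriv t τ hτ i).sub_const 1) (fun τ hτ h1 _ => by
          rw [if_neg]
          rintro ⟨-, h⟩
          simp only [Pi.sub_apply] at h1
          linarith) τ hτ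
      simpa using this

lemma monotoneOn_x (hR : IsRun k σ r s R) (hk : 1 ≤ k) :
    MonotoneOn R.x (Icc 0 (R.time (Fin.last T))) := by
  suffices ∀ i, AntitoneOn (fun τ => -R.x τ i) (Icc 0 (R.time (Fin.last T))) from
    fun u hu w hw huw i => neg_le_neg_iff.1 (this i hu hw huw)
  refine fun i => hR.antitoneOn_of_rounds fun t => antitoneOn_of_rightDeriv_nonpos
    (hR.continuousOn_round t i).neg (fun τ hτ => (hR.x_deriv t τ hτ i).neg) fun τ hτ => ?_
  rw [neg_nonpos]
  split_ifs with h
  · have := (hR.x_mem_Icc hk (hR.round_subset t (Ioo_subset_Icc_self hτ)) i).1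
    exact mul_nonneg (hR.rate_pos t τ hτ i h.1 h.2).le (by positivity)
  · exact le_rfl

lemma feasible_final (hR : IsRun k σ r s R) (hk : 1 ≤ k) : Feasible k σ R.final := by
  have hlast := right_mem_Icc.2 (hR.time_nonneg (Fin.last T))
  refine ⟨fun t => (hR.served t).trans (Finset.sum_le_sum fun i _ => ?_), fun i =>
    hR.x_mem_Icc hk hlast i⟩
  exact hR.monotoneOn_x hk ⟨hR.time_nonneg _, hR.monotone_time (Fin.le_last _)⟩ hlast
    (hR.monotone_time (Fin.le_last _)) i

end IsRun

/-! ### The competitive ratio -/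

section Competitive

variable {P : Type*} [DecidableEq P] {T : ℕ} {k : ℕ} {q : ℝ} {σ : Fin T → P}
  {f : (Fin T → ℝ) → ℝ} {R : Execution T}

lemma IsObjectiveRun.le_two_mul_log_mul_inner (hf : IsObjective q f) (hk : 1 ≤ k)
    (hR : IsObjectiveRun k q σ f R) {y : Fin T → ℝ} (hy : Feasible k σ y) :
    f R.final ≤ 2 * (Real.log (k + 1) * ∑ i, partialDeriv f i R.final * y i) := by
  have hk' : (1 : ℝ) ≤ k := by exact_mod_cast hk
  have hlast := right_mem_Icc.2 (hR.time_nonneg (Fin.last T))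
  have hmaps : MapsTo R.x (Icc 0 (R.time (Fin.last T))) (Ici 0) := fun τ hτ i =>
    (hR.x_mem_Icc hk hτ i).1
  have hpos : ∀ τ ∈ Icc 0 (R.time (Fin.last T)), ∀ i, 0 < 1 + k * R.x τ i := fun τ hτ i => by
    have := hmaps hτ i
    simp only [Pi.zero_apply] at this
    positivity
  have hcoef : ∀ i, 0 ≤ partialDeriv f i R.final * y i := fun i =>
    mul_nonneg (hf.partialDeriv_nonneg (hmaps hlast) i) (hy.2 i).1
  -- The weights use the gradient at the final point, so they are constant in τ and only the
  -- logarithms move.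
  have hanti : AntitoneOn (fun τ => f (R.x τ) -
      2 * ∑ i, partialDeriv f i R.final * y i * Real.log (1 + k * R.x τ i))
      (Icc 0 (R.time (Fin.last T))) := by
    refine hR.antitoneOn_of_rounds fun t => ?_
    have hsub := hR.round_subset t
    refine antitoneOn_of_rightDeriv_nonpos
      (g' := fun τ => ∑ i, partialDeriv f i (R.x τ) *
          (if i ∈ activeVars σ t ∧ R.x τ i < 1
            then (partialDeriv f i (R.x τ))⁻¹ * (R.x τ i + 1 / (k : ℝ)) else 0) -
        2 * ∑ i, partialDeriv f i R.final * y i * (k *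
          (if i ∈ activeVars σ t ∧ R.x τ i < 1
            then (partialDeriv f i (R.x τ))⁻¹ * (R.x τ i + 1 / (k : ℝ)) else 0) /
              (1 + k * R.x τ i))) ?_ ?_ ?_
    · refine ((hf.smooth.continuousOn.comp hR.x_cont hmaps).mono hsub).sub
        (continuousOn_const.mul (continuousOn_finsetSum _ fun i _ => continuousOn_const.mul
          (ContinuousOn.log (continuousOn_const.add
            (continuousOn_const.mul (hR.continuousOn_round t i))) fun τ hτ =>
              (hpos τ (hsub hτ) i).ne')))
    · intro τ hτ
      have hτ' := hsub (Ioo_subset_Icc_self hτ)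
      refine HasDerivWithinAt.sub ?_ (HasDerivWithinAt.const_mul 2
        (HasDerivWithinAt.fun_sum fun i _ => HasDerivWithinAt.const_mul _ ?_))
      -- The chain rule needs the curve to stay in the orthant, which is known only up to the end of
      -- the round.
      · refine (hasDerivWithinAt_comp_curve (s := Icc τ (R.time t.succ)) hf.differentiableOn
          (left_mem_Icc.2 hτ.2.le) (fun u hu => hmaps (hsub ⟨hτ.1.le.trans hu.1, hu.2⟩))
          fun i => (hR.x_deriv t τ hτ i).mono Icc_subset_Ici_self).mono_of_mem_nhdsWithin
            (Icc_mem_nhdsGE hτ.2)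
      · exact (((hR.x_deriv t τ hτ i).const_mul _).const_add _).log (hpos τ hτ' i).ne'
    · intro τ hτ
      have hτ' := hsub (Ioo_subset_Icc_self hτ)
      have hx := hR.x_mem_Icc hk hτ'
      have hle := hR.monotoneOn_x hk hτ' hlast hτ'.2
      have key := sum_add_inv_le_two_mul_sum hk (fun i => (hx i).1) (fun i => (hx i).2)
        (hR.not_served t τ (Ioo_subset_Ico_self hτ)) (fun i => (hy.2 i).2) (hy.1 t)
      have hD : ∀ i ∈ activeVars σ t, R.x τ i < 1 → 0 < partialDeriv f i (R.x τ) :=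
        fun i hi h1 => inv_pos.1 (hR.rate_pos t τ hτ i hi h1)
      have hN : ∀ F : Fin T → ℝ, ∑ i, (if i ∈ activeVars σ t ∧ R.x τ i < 1 then F i else 0)
          = ∑ i ∈ (activeVars σ t).filter (R.x τ · < 1), F i := fun F => by
        rw [← Finset.sum_filter]
        congr 1
        ext i
        simp
      rw [sub_nonpos]
      refine le_trans (le_of_eq ?_) (key.trans (mul_le_mul_of_nonneg_left ?_ zero_le_two))
      · rw [← hN]
        refine Finset.sum_congr rfl fun i _ => ?_
        split_ifs with h
        · rw [mul_inv_cancel_left₀ (hD i h.1 h.2).ne']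
        · rw [mul_zero]
      · rw [← hN]
        refine Finset.sum_le_sum fun i _ => ?_
        split_ifs with h
        · have hi := hD i h.1 h.2
          have h1 := hpos τ hτ' i
          -- The offset 1/k in the dynamics is what makes the logarithm move at exactly the rate
          -- 1/∂ᵢf.
          have h2 : k * ((partialDeriv f i (R.x τ))⁻¹ * (R.x τ i + 1 / (k : ℝ))) /
              (1 + k * R.x τ i) = (partialDeriv f i (R.x τ))⁻¹ := by
            field_simp
            ring
          rw [h2, mul_right_comm, ← div_eq_mul_inv]
          refine le_mul_of_one_le_left (hy.2 i).1 ((one_le_div hi).2 ?_)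
          exact hf.grad_mono i (hmaps hτ') (hmaps hlast) hle
        · simp
  have h := hanti (left_mem_Icc.2 hlast.1) hlast hlast.1
  simp only [hR.x_zero, hf.zero, Pi.zero_apply, mul_zero, add_zero, Real.log_one,
    Finset.sum_const_zero, sub_zero, sub_nonpos] at h
  refine h.trans (mul_le_mul_of_nonneg_left ?_ zero_le_two)
  rw [Finset.mul_sum]
  refine Finset.sum_le_sum fun i _ => ?_
  rw [mul_comm (Real.log _)]
  refine mul_le_mul_of_nonneg_left (Real.log_le_log (hpos _ hlast i) ?_) (hcoef i)
  nlinarith [(hR.x_mem_Icc hk hlast i).2]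

theorem IsObjectiveRun.competitive (hf : IsObjective q f) (hk : 1 ≤ k) (hq : 1 ≤ q)
    (hR : IsObjectiveRun k q σ f R) {y : Fin T → ℝ} (hy : Feasible k σ y) :
    f R.final ≤ (2 * q * Real.log (k + 1)) ^ q * f y := by
  have hk' : (1 : ℝ) ≤ k := by exact_mod_cast hk
  have hx : 0 ≤ R.final := fun i => ((hR.feasible_final hk).2 i).1
  have hy0 : 0 ≤ y := fun i => (hy.2 i).1
  have hlog : 1 / 2 < Real.log (k + 1) := by
    have h2 : Real.log 2 ≤ Real.log (k + 1) := Real.log_le_log (by norm_num) (by linarith)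
    linarith [Real.log_two_gt_d9]
  obtain ⟨L, hL⟩ : ∃ L, L = 2 * q * Real.log (k + 1) := ⟨_, rfl⟩
  -- Needed to apply the growth bound with scaling factor L⁻¹ ≤ 1; this is where ln(k+1) > 1/2
  -- enters.
  have hL1 : 1 ≤ L := by rw [hL]; nlinarith
  have hL0 : 0 < L := by linarith
  have hLy : 0 ≤ L • y := smul_nonneg hL0.le hy0
  have h1 := hf.rpow_mul_le hLy (inv_pos.2 hL0) (inv_le_one_of_one_le₀ hL1)
  rw [inv_smul_smul₀ hL0.ne', Real.inv_rpow hL0.le, inv_mul_le_iff₀ (by positivity)] at h1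
  have h2 := hf.gradient_le hx hLy
  simp only [Pi.smul_apply, smul_eq_mul, mul_sub, Finset.sum_sub_distrib] at h2
  have h3 := hf.growth _ hx
  have h4 := hR.le_two_mul_log_mul_inner hf hk hy
  have h5 : ∑ i, partialDeriv f i R.final * (L * y i)
      = q * (2 * (Real.log (k + 1) * ∑ i, partialDeriv f i R.final * y i)) := by
    rw [hL, Finset.mul_sum, Finset.mul_sum, Finset.mul_sum]
    exact Finset.sum_congr rfl fun i _ => by ring
  have h6 := mul_le_mul_of_nonneg_left h4 (zero_le_one.trans hq)
  rw [← hL]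
  linarith

end Competitive

/-! ### One step of the discretised dynamics -/

/-- A step of length `δ` of the discretised dynamics: each variable in `A` is raised, the others being
frozen, until the objective has grown by `δ (x i + b)` or the variable has reached `1`. -/
structure IsStep {T : ℕ} (f : (Fin T → ℝ) → ℝ) (A : Finset (Fin T)) (b δ : ℝ)
    (x x' : Fin T → ℝ) : Prop where
  le : x ≤ x'
  le_one : x' ≤ 1
  const : ∀ i, i ∉ A → x' i = x i
  upper : ∀ i ∈ A, f (Function.update x i (x' i)) - f x ≤ δ * (x i + b)
  reach : ∀ i ∈ A, x' i < 1 → f (Function.update x i (x' i)) - f x = δ * (x i + b)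

section Step

variable {T : ℕ} {q : ℝ} {f : (Fin T → ℝ) → ℝ} {A : Finset (Fin T)} {b δ : ℝ}

lemma update_nonneg {x : Fin T → ℝ} (hx : 0 ≤ x) {i : Fin T} {a : ℝ} (ha : 0 ≤ a) :
    0 ≤ Function.update x i a := by
  intro j
  rcases eq_or_ne j i with rfl | hj
  · simpa using ha
  · simpa [hj] using hx j

lemma update_eq_add_single (x : Fin T → ℝ) (i : Fin T) (a : ℝ) :
    Function.update x i a = x + Pi.single i (a - x i) := by
  ext j
  rcases eq_or_ne j i with rfl | hj
  · simp
  · simp [hj]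

/-- Intermediate values of f along each coordinate, capped at 1. No division by a partial derivative
occurs, so points with ∂ᵢf = 0 cause no trouble. -/
lemma IsObjective.exists_isStep (hf : IsObjective q f) (A : Finset (Fin T)) (hb : 0 ≤ b)
    (hδ : 0 ≤ δ) {x : Fin T → ℝ} (hx : x ∈ Icc (0 : Fin T → ℝ) 1) :
    ∃ x', IsStep f A b δ x x' := by
  have h1 : ∀ i, ∃ a ∈ Icc (x i) 1, f (Function.update x i a) - f x ≤ δ * (x i + b) ∧
      (a < 1 → f (Function.update x i a) - f x = δ * (x i + b)) := by
    intro i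
    have hi : x i ≤ 1 := hx.2 i
    by_cases h : f (Function.update x i 1) - f x ≤ δ * (x i + b)
    · exact ⟨1, right_mem_Icc.2 hi, h, fun h => absurd h (lt_irrefl _)⟩
    · have hc : ContinuousOn (fun a => f (Function.update x i a) - f x) (Icc (x i) 1) :=
        (hf.smooth.continuousOn.comp (continuous_const.update i continuous_id).continuousOn
          fun a ha => update_nonneg hx.1 ((hx.1 i).trans ha.1)).sub continuousOn_const
      have h0 : δ * (x i + b) ∈ Icc (f (Function.update x i (x i)) - f x)
          (f (Function.update x i 1) - f x) := by
        rw [Function.update_eq_self, sub_self]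
        exact ⟨mul_nonneg hδ (add_nonneg (hx.1 i) hb), (not_le.1 h).le⟩
      obtain ⟨a, ha, hfa⟩ := intermediate_value_Icc hi hc h0
      exact ⟨a, ha, hfa.le, fun _ => hfa⟩
  choose a ha hu hr using h1
  refine ⟨fun i => if i ∈ A then a i else x i, fun i => ?_, fun i => ?_, fun i hi => if_neg hi,
    fun i hi => ?_, fun i hi => ?_⟩
  · dsimp only
    split_ifs
    exacts [(ha i).1, le_rfl]
  · dsimp only
    split_ifs
    exacts [(ha i).2, hx.2 i]
  · simpa [hi] using hu i
  · simpa [hi] using hr i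

/-- The same increment taken on the axis, with all other coordinates 0, costs no more; this removes
the dependence on the other variables. -/
lemma IsStep.single_sub_le (hf : IsObjective q f) {x x' : Fin T → ℝ} (hx : 0 ≤ x)
    (h : IsStep f A b δ x x') {i : Fin T} (hi : i ∈ A) :
    f (Pi.single i (x' i)) - f (Pi.single i (x i)) ≤ δ * (x i + b) := by
  refine le_trans ?_ (h.upper i hi)
  have hs : (Pi.single i (x' i) : Fin T → ℝ) = Pi.single i (x i) + Pi.single i (x' i - x i) := by
    rw [← Pi.single_add]; simp
  rw [update_eq_add_single, hs]
  refine hf.increment_mono (Pi.single_nonneg.2 (hx i)) (fun j => ?_)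
    (Pi.single_nonneg.2 (sub_nonneg.2 (h.le i)))
  rcases eq_or_ne j i with rfl | hj
  · simp
  · simpa [hj] using hx j

lemma IsStep.partialDeriv_mul_le (hf : IsObjective q f) {x x' : Fin T → ℝ} (hx : 0 ≤ x)
    (h : IsStep f A b δ x x') {i : Fin T} (hi : i ∈ A) :
    partialDeriv f i x * (x' i - x i) ≤ δ * (x i + b) := by
  refine le_trans ?_ (h.upper i hi)
  have := hf.gradient_le hx (update_nonneg hx (i := i) ((hx i).trans (h.le i)))
  rwa [Finset.sum_eq_single i (fun j _ hj => by simp [hj]) (by simp),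
    Function.update_self] at this

/-- The tangent inequality based at the raised point bounds the growth of f from above; based at the
old point it gives the opposite estimate of the step. -/
lemma IsStep.le_partialDeriv_mul (hf : IsObjective q f) {x x' : Fin T → ℝ} (hx : 0 ≤ x)
    (h : IsStep f A b δ x x') {i : Fin T} (hi : i ∈ A) (h1 : x' i < 1) :
    δ * (x i + b) ≤ partialDeriv f i (Function.update x i (x' i)) * (x' i - x i) := by
  have := hf.gradient_le (update_nonneg hx (i := i) ((hx i).trans (h.le i))) hx
  rw [Finset.sum_eq_single i (fun j _ hj => by simp [hj]) (by simp),
    Function.update_self] at this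
  linarith [h.reach i hi h1]

end Step

/-! ### Discrete trajectories -/

section Trajectory

variable {T : ℕ} {q : ℝ} {f : (Fin T → ℝ) → ℝ} {A : Finset (Fin T)} {b δ : ℝ}
  {Y : ℕ → Fin T → ℝ}

lemma IsObjective.exists_trajectory (hf : IsObjective q f) (A : Finset (Fin T)) (hb : 0 ≤ b)
    (hδ : 0 ≤ δ) {x₀ : Fin T → ℝ} (hx₀ : x₀ ∈ Icc (0 : Fin T → ℝ) 1) :
    ∃ Y : ℕ → Fin T → ℝ, Y 0 = x₀ ∧ ∀ m, IsStep f A b δ (Y m) (Y (m + 1)) := by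
  have h : ∀ x : Icc (0 : Fin T → ℝ) 1, ∃ x' : Icc (0 : Fin T → ℝ) 1, IsStep f A b δ x x' := by
    intro x
    obtain ⟨x', hx'⟩ := hf.exists_isStep A hb hδ x.2
    exact ⟨⟨x', x.2.1.trans hx'.le, hx'.le_one⟩, hx'⟩
  choose S hS using h
  refine ⟨fun m => (S^[m] ⟨x₀, hx₀⟩ : Icc (0 : Fin T → ℝ) 1), rfl, fun m => ?_⟩
  simp only [Function.iterate_succ_apply']
  exact hS _

lemma monotone_of_isStep (hY : ∀ m, IsStep f A b δ (Y m) (Y (m + 1))) : Monotone Y :=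
  monotone_nat_of_le_succ fun m => (hY m).le

lemma eq_of_isStep (hY : ∀ m, IsStep f A b δ (Y m) (Y (m + 1))) {i : Fin T} (hi : i ∉ A) (m : ℕ) :
    Y m i = Y 0 i := by
  induction m with
  | zero => rfl
  | succ m ih => rw [(hY m).const i hi, ih]

lemma mem_Icc_of_isStep (hY : ∀ m, IsStep f A b δ (Y m) (Y (m + 1)))
    (h0 : Y 0 ∈ Icc (0 : Fin T → ℝ) 1) (m : ℕ) : Y m ∈ Icc (0 : Fin T → ℝ) 1 := by
  refine ⟨h0.1.trans (monotone_of_isStep hY (Nat.zero_le m)), ?_⟩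
  cases m with
  | zero => exact h0.2
  | succ m => exact (hY m).le_one

/-- Telescoping of the axis increments, followed by f(v) ≤ f(u + v) - f(u) on the axis. The bound
depends on the elapsed time mδ alone, so it is a modulus of continuity uniform in the step size. -/
lemma single_sub_le_of_isStep (hf : IsObjective q f) (hb : 0 ≤ b) (hδ : 0 ≤ δ)
    (hY : ∀ m, IsStep f A b δ (Y m) (Y (m + 1))) (h0 : Y 0 ∈ Icc (0 : Fin T → ℝ) 1)
    (i : Fin T) {m m' : ℕ} (hm : m ≤ m') :
    f (Pi.single i (Y m' i - Y m i)) ≤ (m' * δ - m * δ) * (1 + b) := by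
  by_cases hi : i ∈ A
  · have key : f (Pi.single i (Y m' i)) - f (Pi.single i (Y m i))
        ≤ (m' * δ - m * δ) * (1 + b) := by
      induction m', hm using Nat.le_induction with
      | base => simp
      | succ n hn ih =>
        have h1 := (hY n).single_sub_le hf (mem_Icc_of_isStep hY h0 n).1 hi
        have h3 : Y n i ≤ 1 := (mem_Icc_of_isStep hY h0 n).2 i
        have h2 : δ * (Y n i + b) ≤ δ * (1 + b) :=
          mul_le_mul_of_nonneg_left (by linarith) hδ
        push_cast
        linarith
    refine le_trans ?_ key
    have h1 := (mem_Icc_of_isStep hY h0 m).1 i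
    have h2 := monotone_of_isStep hY hm i
    have := hf.increment_mono le_rfl
      (Pi.single_nonneg.2 h1 : 0 ≤ (Pi.single i (Y m i) : Fin T → ℝ))
      (Pi.single_nonneg.2 (sub_nonneg.2 h2) : 0 ≤ (Pi.single i (Y m' i - Y m i) : Fin T → ℝ))
    rw [← Pi.single_add, zero_add, hf.zero, sub_zero] at this
    simpa using this
  · rw [eq_of_isStep hY hi, eq_of_isStep hY hi m, sub_self, Pi.single_zero, hf.zero, ← sub_mul]
    have : (m : ℝ) ≤ m' := by exact_mod_cast hm
    exact mul_nonneg (mul_nonneg (sub_nonneg.2 this) hδ) (by linarith)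

lemma sub_le_of_isStep (hf : IsObjective q f) (hb : 0 ≤ b) (hδ : 0 ≤ δ)
    (hY : ∀ m, IsStep f A b δ (Y m) (Y (m + 1))) (h0 : Y 0 ∈ Icc (0 : Fin T → ℝ) 1)
    (i : Fin T) {m m' : ℕ} (hm : m ≤ m') {η : ℝ} (hη : 0 ≤ η)
    (h : (m' * δ - m * δ) * (1 + b) < f (Pi.single i η)) : Y m' i - Y m i ≤ η := by
  by_contra! hlt
  refine absurd ((single_sub_le_of_isStep hf hb hδ hY h0 i hm).trans_lt h) (not_lt.2 ?_)
  refine hf.mono (mem_Ici.2 (Pi.single_nonneg.2 hη))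
    (mem_Ici.2 (Pi.single_nonneg.2 (hη.trans hlt.le))) fun j => ?_
  rcases eq_or_ne j i with rfl | hj
  · simpa using hlt.le
  · simp [hj]

/-- On the cube ∂ᵢf is largest at the corner 1, so each uncapped step raises the variable by at
least δ b/∂ᵢf(1). This gives immediate positivity and arrival at 1 in finite time. -/
lemma min_le_of_isStep (hf : IsObjective q f) (hδ : 0 ≤ δ)
    (hY : ∀ m, IsStep f A b δ (Y m) (Y (m + 1))) (h0 : Y 0 ∈ Icc (0 : Fin T → ℝ) 1)
    {i : Fin T} (hi : i ∈ A) (m : ℕ) : min 1 (m * δ * (b / partialDeriv f i 1)) ≤ Y m i := by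
  have hG : 0 < partialDeriv f i 1 := hf.partialDeriv_pos zero_le_one (by simp)
  induction m with
  | zero => simpa using h0.1 i
  | succ m ih =>
    have hm := mem_Icc_of_isStep hY h0 m
    have hm' := mem_Icc_of_isStep hY h0 (m + 1)
    rcases (hm'.2 i).lt_or_eq with h1 | h1
    · have h2 := (hY m).le_partialDeriv_mul hf hm.1 hi h1
      have h3 : partialDeriv f i (Function.update (Y m) i (Y (m + 1) i)) ≤ partialDeriv f i 1 := by
        refine hf.grad_mono i (update_nonneg hm.1 (hm'.1 i)) (mem_Ici.2 zero_le_one) fun j => ?_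
        rcases eq_or_ne j i with rfl | hj
        · simpa using hm'.2 j
        · simpa [hj] using hm.2 j
      have h4 : δ * b ≤ partialDeriv f i 1 * (Y (m + 1) i - Y m i) :=
        le_trans (mul_le_mul_of_nonneg_left (by linarith [show 0 ≤ Y m i from hm.1 i]) hδ)
          (h2.trans (mul_le_mul_of_nonneg_right h3 (sub_nonneg.2 ((hY m).le i))))
      have h5 : δ * (b / partialDeriv f i 1) ≤ Y (m + 1) i - Y m i := by
        rw [← mul_div_assoc, div_le_iff₀ hG]; linarith
      have h6 : Y m i < 1 := lt_of_le_of_lt ((hY m).le i) h1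
      rcases min_le_iff.1 ih with h | h
      · exact absurd h (not_le.2 h6)
      · refine min_le_iff.2 (Or.inr ?_)
        push_cast
        linarith
    · exact min_le_iff.2 (Or.inl h1.ge)

/-- As long as a trajectory stays in a box on which the rate of the `i`-th variable is between `lo`
and `hi`, so is its average speed. -/
lemma speed_of_isStep (hf : IsObjective q f) (hδ : 0 ≤ δ)
    (hY : ∀ m, IsStep f A b δ (Y m) (Y (m + 1))) (h0 : Y 0 ∈ Icc (0 : Fin T → ℝ) 1)
    {i : Fin T} (hi : i ∈ A) {l u : Fin T → ℝ} {lo hi' c : ℝ}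
    (hbox : ∀ z, 0 ≤ z → (∀ j, z j ∈ Ioo (l j) (u j)) → 0 < partialDeriv f i z ∧
      lo * partialDeriv f i z ≤ c ∧ c ≤ z i + b ∧ z i + b ≤ hi' * partialDeriv f i z)
    {m m' : ℕ} (hm : m ≤ m') (hl : ∀ j, l j < Y m j) (hu : ∀ j, Y m' j < u j) (h1 : Y m' i < 1) :
    lo * (m' * δ - m * δ) ≤ Y m' i - Y m i ∧ Y m' i - Y m i ≤ hi' * (m' * δ - m * δ) := by
  induction m', hm using Nat.le_induction with
  | base => simp
  | succ n hn ih =>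
    have hstep := (hY n).le
    obtain ⟨ih1, ih2⟩ := ih (fun j => (hstep j).trans_lt (hu j)) ((hstep i).trans_lt h1)
    have hn0 := mem_Icc_of_isStep hY h0 n
    have hmn := monotone_of_isStep hY hn
    obtain ⟨p1, -, p3, p4⟩ := hbox (Y n) hn0.1
      fun j => ⟨(hl j).trans_le (hmn j), (hstep j).trans_lt (hu j)⟩
    -- The lower estimate has its numerator at the old point and its derivative at the raised one;
    -- the constant c separates them so that both can vary independently in the box.
    obtain ⟨r1, r2, -, -⟩ := hbox (Function.update (Y n) i (Y (n + 1) i))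
      (update_nonneg hn0.1 ((hn0.1 i).trans (hstep i))) fun j => by
        rcases eq_or_ne j i with rfl | hj
        · simpa using ⟨(hl j).trans_le ((hmn j).trans (hstep j)), hu j⟩
        · simpa [hj] using ⟨(hl j).trans_le (hmn j), (hstep j).trans_lt (hu j)⟩
    have s1 := (hY n).partialDeriv_mul_le hf hn0.1 hi
    have s2 := (hY n).le_partialDeriv_mul hf hn0.1 hi h1
    have t1 : Y (n + 1) i - Y n i ≤ δ * hi' := by
      refine le_of_mul_le_mul_left (s1.trans ?_) p1
      nlinarith [mul_le_mul_of_nonneg_left p4 hδ]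
    have t2 : δ * lo ≤ Y (n + 1) i - Y n i := by
      refine le_of_mul_le_mul_left (le_trans ?_ s2) r1
      nlinarith [mul_le_mul_of_nonneg_left (r2.trans p3) hδ]
    push_cast
    constructor <;> linarith

end Trajectory

/-! ### The continuous dynamics -/

lemma tendsto_floor_mul_inv {τ : ℝ} (hτ : 0 ≤ τ) :
    Tendsto (fun n : ℕ => (⌊τ * ((n : ℝ) + 1)⌋₊ : ℝ) * ((n : ℝ) + 1)⁻¹) atTop (𝓝 τ) := by
  have h := tendsto_nat_floor_mul_div_atTop (R := ℝ) hτ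
  have h2 : Tendsto (fun n : ℕ => (n : ℝ) + 1) atTop atTop :=
    tendsto_atTop_add_const_right _ _ tendsto_natCast_atTop_atTop
  exact h.comp h2

lemma floor_mul_mono {σ τ : ℝ} (h : σ ≤ τ) (n : ℕ) :
    ⌊σ * ((n : ℝ) + 1)⌋₊ ≤ ⌊τ * ((n : ℝ) + 1)⌋₊ :=
  Nat.floor_mono (mul_le_mul_of_nonneg_right h (by positivity))

section Flow

variable {T : ℕ} {q : ℝ} {f : (Fin T → ℝ) → ℝ} {A : Finset (Fin T)} {b : ℝ}

/-- `w` solves the differential equations for the variables in `A`, stopped at `1`. -/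
structure IsFlow (f : (Fin T → ℝ) → ℝ) (A : Finset (Fin T)) (b : ℝ) (x₀ : Fin T → ℝ)
    (w : ℝ → Fin T → ℝ) : Prop where
  init : w 0 = x₀
  cont : ContinuousOn w (Ici 0)
  mem : ∀ τ, 0 ≤ τ → w τ ∈ Icc (0 : Fin T → ℝ) 1
  mono : MonotoneOn w (Ici 0)
  const : ∀ i, i ∉ A → ∀ τ, 0 ≤ τ → w τ i = x₀ i
  min_le : ∀ i ∈ A, ∃ c > 0, ∀ τ, 0 ≤ τ → min 1 (τ * c) ≤ w τ i
  pos : ∀ i ∈ A, ∀ τ, 0 < τ → 0 < partialDeriv f i (w τ)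
  deriv : ∀ i ∈ A, ∀ τ, 0 < τ → w τ i < 1 →
    HasDerivAt (fun u => w u i) ((partialDeriv f i (w τ))⁻¹ * (w τ i + b)) τ

lemma hasDerivAt_of_lipschitz_bounds {g : ℝ → ℝ} {D τ : ℝ}
    (h : ∀ lo hi, lo < D → D < hi → ∃ a c, τ ∈ Ioo a c ∧ ∀ σ s, a ≤ σ → σ ≤ s → s ≤ c →
      lo * (s - σ) ≤ g s - g σ ∧ g s - g σ ≤ hi * (s - σ)) : HasDerivAt g D τ := by
  rw [hasDerivAt_iff_tendsto_slope]
  have key : ∀ lo hi, lo < D → D < hi → ∀ᶠ s in 𝓝[≠] τ, lo ≤ slope g τ s ∧ slope g τ s ≤ hi := by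
    intro lo hi hlo hhi
    obtain ⟨a, c, hτ, hac⟩ := h lo hi hlo hhi
    filter_upwards [mem_nhdsWithin_of_mem_nhds (Ioo_mem_nhds hτ.1 hτ.2), self_mem_nhdsWithin]
      with s hs hne
    rcases lt_or_gt_of_ne (show s ≠ τ from hne) with hlt | hlt
    · have := hac s τ hs.1.le hlt.le hτ.2.le
      rw [slope_comm, slope_def_field, le_div_iff₀ (sub_pos.2 hlt), div_le_iff₀ (sub_pos.2 hlt)]
      exact this
    · have := hac τ s hτ.1.le hlt.le hs.2.le
      rw [slope_def_field, le_div_iff₀ (sub_pos.2 hlt), div_le_iff₀ (sub_pos.2 hlt)]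
      exact this
  refine tendsto_order.2 ⟨fun a ha => ?_, fun a ha => ?_⟩
  · obtain ⟨a', h1, h2⟩ := exists_between ha
    exact (key a' (D + 1) h2 (lt_add_one D)).mono fun s hs => h1.trans_le hs.1
  · obtain ⟨a', h1, h2⟩ := exists_between ha
    exact (key (D - 1) a' (sub_one_lt D) h1).mono fun s hs => hs.2.trans_lt h2

/-- Near a point at which the rate of the `i`-th variable lies strictly between `lo` and `hi` there
is a box on which it does so uniformly. -/
lemma IsObjective.exists_box (hf : IsObjective q f) {p : Fin T → ℝ} (hp : 0 ≤ p) {i : Fin T}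
    (hpos : 0 < partialDeriv f i p) {lo hi : ℝ}
    (hlo : lo < (partialDeriv f i p)⁻¹ * (p i + b)) (hhi : (partialDeriv f i p)⁻¹ * (p i + b) < hi) :
    ∃ c, ∃ η > 0, ∀ z, 0 ≤ z → (∀ j, z j ∈ Ioo (p j - η) (p j + η)) → 0 < partialDeriv f i z ∧
      lo * partialDeriv f i z ≤ c ∧ c ≤ z i + b ∧ z i + b ≤ hi * partialDeriv f i z := by
  rw [inv_mul_eq_div] at hlo hhi
  rw [lt_div_iff₀ hpos] at hlo
  rw [div_lt_iff₀ hpos] at hhi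
  obtain ⟨c, hc1, hc2⟩ := exists_between hlo
  have hD : Tendsto (partialDeriv f i) (𝓝[Ici 0] p) (𝓝 (partialDeriv f i p)) :=
    continuousOn_partialDeriv hf.smooth i p hp
  have hI : Tendsto (fun z : Fin T → ℝ => z i + b) (𝓝[Ici 0] p) (𝓝 (p i + b)) :=
    (((continuous_apply i).tendsto p).mono_left nhdsWithin_le_nhds).add_const b
  have hev := (hD.eventually (lt_mem_nhds hpos)).and
    (((hD.const_mul lo).eventually (gt_mem_nhds hc1)).and
    ((hI.eventually (lt_mem_nhds hc2)).and
      ((hI.sub (hD.const_mul hi)).eventually (gt_mem_nhds (sub_neg.2 hhi)))))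
  obtain ⟨η, hη, hsub⟩ := Metric.mem_nhdsWithin_iff.1 hev
  refine ⟨c, η, hη, fun z hz hzb => ?_⟩
  have hzm : z ∈ Metric.ball p η ∩ Ici 0 := by
    refine ⟨(dist_pi_lt_iff hη).2 fun j => ?_, hz⟩
    rw [Real.dist_eq, abs_lt]
    exact ⟨by linarith [(hzb j).1], by linarith [(hzb j).2]⟩
  obtain ⟨h1, h2, h3, h4⟩ := hsub hzm
  exact ⟨h1, h2.le, h3.le, (sub_neg.1 h4).le⟩

theorem IsObjective.exists_isFlow (hf : IsObjective q f) (A : Finset (Fin T)) (hb : 0 < b)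
    {x₀ : Fin T → ℝ} (hx₀ : x₀ ∈ Icc (0 : Fin T → ℝ) 1) : ∃ w, IsFlow f A b x₀ w := by
  have hδ : ∀ n : ℕ, 0 ≤ ((n : ℝ) + 1)⁻¹ := fun n => by positivity
  choose Y hY0 hY using fun n : ℕ => hf.exists_trajectory A hb.le (hδ n) hx₀
  have hYI : ∀ n m, Y n m ∈ Icc (0 : Fin T → ℝ) 1 := fun n =>
    mem_Icc_of_isStep (hY n) (by rw [hY0]; exact hx₀)
  have hY0' : ∀ n, Y n 0 ∈ Icc (0 : Fin T → ℝ) 1 := fun n => hYI n 0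
  -- Compactness of the cube gives a limit along one fixed ultrafilter for every τ simultaneously,
  -- so no subsequence has to be extracted.
  have hlim : ∀ τ : ℝ, ∃ x ∈ Icc (0 : Fin T → ℝ) 1,
      Tendsto (fun n => Y n ⌊τ * ((n : ℝ) + 1)⌋₊) (hyperfilter ℕ) (𝓝 x) := fun τ =>
    (isCompact_Icc (a := (0 : Fin T → ℝ)) (b := 1)).ultrafilter_le_nhds'
      ((hyperfilter ℕ).map fun n => Y n ⌊τ * ((n : ℝ) + 1)⌋₊)
      (Ultrafilter.mem_map.2 (Filter.univ_mem' fun n => hYI n _))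
  choose w hw hwl using hlim
  have hwi : ∀ τ i, Tendsto (fun n => Y n ⌊τ * ((n : ℝ) + 1)⌋₊ i) (hyperfilter ℕ) (𝓝 (w τ i)) :=
    fun τ i => tendsto_pi_nhds.1 (hwl τ) i
  have hfl : ∀ τ, 0 ≤ τ → Tendsto
      (fun n : ℕ => (⌊τ * ((n : ℝ) + 1)⌋₊ : ℝ) * ((n : ℝ) + 1)⁻¹) (hyperfilter ℕ) (𝓝 τ) :=
    fun τ hτ => (tendsto_floor_mul_inv hτ).mono_left Nat.hyperfilter_le_atTop
  have hmono : Monotone w := fun σ τ h => le_of_tendsto_of_tendsto' (hwl σ) (hwl τ) fun n =>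
    monotone_of_isStep (hY n) (floor_mul_mono h n)
  have hmod : ∀ i σ τ η, 0 ≤ σ → σ ≤ τ → 0 ≤ η → (τ - σ) * (1 + b) < f (Pi.single i η) →
      w τ i - w σ i ≤ η := by
    intro i σ τ η hσ hστ hη h
    refine le_of_tendsto ((hwi τ i).sub (hwi σ i)) ?_
    filter_upwards [(((hfl τ (hσ.trans hστ)).sub (hfl σ hσ)).mul_const (1 + b)).eventually
      (gt_mem_nhds h)] with n hn
    exact sub_le_of_isStep hf hb.le (hδ n) (hY n) (hY0' n) i (floor_mul_mono hστ n) hη hn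
  have hcont : ContinuousOn w (Ici 0) := by
    refine continuousOn_pi.2 fun i => Metric.continuousOn_iff.2 fun τ hτ ε hε => ?_
    have hp := hf.single_pos i (half_pos hε)
    refine ⟨f (Pi.single i (ε / 2)) / (1 + b), by positivity, fun σ hσ hd => ?_⟩
    rw [Real.dist_eq, lt_div_iff₀ (by positivity)] at hd
    rw [Real.dist_eq]
    rcases le_total σ τ with h | h
    · rw [abs_sub_comm, abs_of_nonneg (sub_nonneg.2 h)] at hd
      rw [abs_sub_comm, abs_of_nonneg (sub_nonneg.2 (hmono h i))]
      linarith [hmod i σ τ (ε / 2) hσ h (half_pos hε).le hd]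
    · rw [abs_of_nonneg (sub_nonneg.2 h)] at hd
      rw [abs_of_nonneg (sub_nonneg.2 (hmono h i))]
      linarith [hmod i τ σ (ε / 2) hτ h (half_pos hε).le hd]
  have hmin : ∀ i ∈ A, ∀ τ, 0 ≤ τ → min 1 (τ * (b / partialDeriv f i 1)) ≤ w τ i := by
    intro i hi τ hτ
    exact le_of_tendsto_of_tendsto' (tendsto_const_nhds.min ((hfl τ hτ).mul_const _)) (hwi τ i)
      fun n => min_le_of_isStep hf (hδ n) (hY n) (hY0' n) hi _
  have hG : ∀ i, 0 < partialDeriv f i 1 := fun i => hf.partialDeriv_pos zero_le_one (by simp)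
  have hpos : ∀ i ∈ A, ∀ τ, 0 < τ → 0 < partialDeriv f i (w τ) := fun i hi τ hτ =>
    hf.partialDeriv_pos (hw τ).1
      (lt_of_lt_of_le (lt_min one_pos (mul_pos hτ (div_pos hb (hG i)))) (hmin i hi τ hτ.le))
  refine ⟨w, ⟨?_, hcont, fun τ _ => hw τ, hmono.monotoneOn _, ?_,
    fun i hi => ⟨_, div_pos hb (hG i), hmin i hi⟩, hpos, ?_⟩⟩
  · refine tendsto_nhds_unique (hwl 0) (tendsto_const_nhds.congr fun n => ?_)
    simp [hY0]
  · intro i hi τ _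
    refine tendsto_nhds_unique (hwi τ i) (tendsto_const_nhds.congr fun n => ?_)
    rw [eq_of_isStep (hY n) hi, hY0]
  · intro i hi τ hτ h1
    refine hasDerivAt_of_lipschitz_bounds fun lo hi' hlo hhi => ?_
    -- Near τ the limit stays in a box with almost constant rate. By monotonicity, checking the two
    -- ends of a time interval keeps the discrete trajectories in the box throughout it, and their
    -- speed bounds pass to the limit.
    obtain ⟨c, η, hη, hbox⟩ := hf.exists_box (hw τ).1 (hpos i hi τ hτ) hlo hhi
    have hev : ∀ᶠ s in 𝓝 τ, 0 < s ∧ w s i < 1 ∧ ∀ j, w s j ∈ Ioo (w τ j - η) (w τ j + η) := by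
      have hcτ : ∀ j, ContinuousAt (fun s => w s j) τ := fun j =>
        (continuousOn_pi.1 hcont j).continuousAt (Ici_mem_nhds hτ)
      exact (lt_mem_nhds hτ).and (((hcτ i).eventually (gt_mem_nhds h1)).and
        (eventually_all.2 fun j => (hcτ j).eventually
          (Ioo_mem_nhds (by linarith) (by linarith))))
    obtain ⟨ρ, hρ, hball⟩ := Metric.nhds_basis_closedBall.mem_iff.1 hev
    rw [Real.closedBall_eq_Icc] at hball
    obtain ⟨ha0, -, haη⟩ := hball (left_mem_Icc.2 (by linarith : τ - ρ ≤ τ + ρ))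
    obtain ⟨-, hc1, hcη⟩ := hball (right_mem_Icc.2 (by linarith : τ - ρ ≤ τ + ρ))
    refine ⟨τ - ρ, τ + ρ, ⟨by linarith, by linarith⟩, fun σ s hσ hσs hs => ?_⟩
    have hσ0 : 0 ≤ σ := ha0.le.trans hσ
    have hev2 : ∀ᶠ n in (hyperfilter ℕ : Filter ℕ), ∀ j,
        w τ j - η < Y n ⌊(τ - ρ) * ((n : ℝ) + 1)⌋₊ j ∧
        Y n ⌊(τ + ρ) * ((n : ℝ) + 1)⌋₊ j < w τ j + η := eventually_all.2 fun j =>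
      ((hwi (τ - ρ) j).eventually (lt_mem_nhds (haη j).1)).and
        ((hwi (τ + ρ) j).eventually (gt_mem_nhds (hcη j).2))
    have hsp : ∀ᶠ n in (hyperfilter ℕ : Filter ℕ), _ :=
      (hev2.and ((hwi (τ + ρ) i).eventually (gt_mem_nhds hc1))).mono fun n hn =>
        speed_of_isStep hf (hδ n) (hY n) (hY0' n) hi hbox (floor_mul_mono hσs n)
          (fun j => (hn.1 j).1.trans_le (monotone_of_isStep (hY n) (floor_mul_mono hσ n) j))
          (fun j => (monotone_of_isStep (hY n) (floor_mul_mono hs n) j).trans_lt (hn.1 j).2)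
          ((monotone_of_isStep (hY n) (floor_mul_mono hs n) i).trans_lt hn.2)
    have ht := (hfl s (hσ0.trans hσs)).sub (hfl σ hσ0)
    have htw := (hwi s i).sub (hwi σ i)
    exact ⟨le_of_tendsto_of_tendsto (ht.const_mul lo) htw (hsp.mono fun n hn => hn.1),
      le_of_tendsto_of_tendsto htw (ht.const_mul hi') (hsp.mono fun n hn => hn.2)⟩

end Flow

/-! ### Restriction to the first variables -/

/-- Extends a vector by zeros. -/
def pad {n : ℕ} (T : ℕ) (x : Fin n → ℝ) : Fin T → ℝ :=
  fun i => if hi : i.1 < n then x ⟨i.1, hi⟩ else 0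

section Pad

variable {n T : ℕ}

@[simp] lemma pad_castLE (h : n ≤ T) (x : Fin n → ℝ) (i : Fin n) :
    pad T x (Fin.castLE h i) = x i := by
  simp [pad]

@[simp] lemma pad_castSucc (x : Fin T → ℝ) (i : Fin T) : pad (T + 1) x i.castSucc = x i := by
  simp [pad]

@[simp] lemma pad_last (x : Fin T → ℝ) : pad (T + 1) x (Fin.last T) = 0 := by
  simp [pad]

lemma pad_eq_zero {x : Fin n → ℝ} {i : Fin T} (hi : ¬ i.1 < n) : pad T x i = 0 := dif_neg hi

lemma pad_zero : pad T (0 : Fin n → ℝ) = 0 := by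
  ext i; simp [pad]

lemma pad_add (x y : Fin n → ℝ) : pad T (x + y) = pad T x + pad T y := by
  ext i; simp only [pad, Pi.add_apply]; split_ifs <;> simp

lemma pad_smul (c : ℝ) (x : Fin n → ℝ) : pad T (c • x) = c • pad T x := by
  ext i; simp only [pad, Pi.smul_apply]; split_ifs <;> simp

lemma pad_mono {x y : Fin n → ℝ} (h : x ≤ y) : pad T x ≤ pad T y := by
  intro i
  simp only [pad]
  split_ifs
  exacts [h _, le_rfl]

lemma pad_nonneg {x : Fin n → ℝ} (h : 0 ≤ x) : 0 ≤ pad T x :=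
  pad_zero (n := n) (T := T) ▸ pad_mono h

lemma pad_single (h : n ≤ T) (i : Fin n) (a : ℝ) :
    pad T (Pi.single i a : Fin n → ℝ) = Pi.single (Fin.castLE h i) a := by
  ext j
  by_cases hj : j.1 < n
  · simp [pad, hj, Pi.single_apply, Fin.ext_iff]
  · have : j ≠ Fin.castLE h i := fun e => hj (by rw [e]; exact i.2)
    simp [pad, hj, this]

lemma sum_mul_pad (h : n ≤ T) (c : Fin T → ℝ) (x : Fin n → ℝ) :
    ∑ i, c i * pad T x i = ∑ i, c (Fin.castLE h i) * x i := by
  symm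
  refine Finset.sum_of_injOn (Fin.castLE h) (Fin.castLE_injective h).injOn
    (fun _ _ => by simp) (fun j _ hj => ?_) fun i _ => by simp
  rw [pad_eq_zero, mul_zero]
  intro hjn
  exact hj ⟨⟨j.1, hjn⟩, by simp, by ext; simp⟩

/-- Extension by zeros as a continuous linear map. -/
noncomputable def padL (n T : ℕ) : (Fin n → ℝ) →L[ℝ] (Fin T → ℝ) :=
  LinearMap.toContinuousLinearMap
    { toFun := pad T
      map_add' := pad_add
      map_smul' := pad_smul }

lemma padL_apply (x : Fin n → ℝ) : padL n T x = pad T x := rfl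

lemma prefixObj_eq_comp (h : n ≤ T) (f : (Fin T → ℝ) → ℝ) : prefixObj h f = f ∘ padL n T := rfl

lemma partialDeriv_prefixObj (h : n ≤ T) {f : (Fin T → ℝ) → ℝ}
    (hf : DifferentiableOn ℝ f (Ici 0)) {x : Fin n → ℝ} (hx : 0 ≤ x) (i : Fin n) :
    partialDeriv (prefixObj h f) i x = partialDeriv f (Fin.castLE h i) (pad T x) := by
  have h1 : HasFDerivWithinAt (f ∘ padL n T) _ (Ici 0) x :=
    (hf _ (pad_nonneg hx)).hasFDerivWithinAt.comp x (padL n T).hasFDerivWithinAt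
      (fun y hy => pad_nonneg hy)
  rw [partialDeriv, prefixObj_eq_comp, h1.fderivWithin (uniqueDiffOn_orthant n x hx),
    ContinuousLinearMap.comp_apply, padL_apply, pad_single h, partialDeriv]

lemma IsObjective.prefixObj {q : ℝ} {f : (Fin T → ℝ) → ℝ} (hf : IsObjective q f) (h : n ≤ T) :
    IsObjective q (prefixObj h f) where
  convex := by
    refine (hf.convex.comp_linearMap (padL n T).toLinearMap).subset (fun x hx => ?_) (convex_Ici 0)
    exact pad_nonneg hx
  smooth := hf.smooth.comp (padL n T).contDiff.contDiffOn fun x hx => pad_nonneg hx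
  zero := by
    change f (pad T 0) = 0
    rw [pad_zero, hf.zero]
  mono := fun x hx y hy hxy => hf.mono (pad_nonneg hx) (pad_nonneg hy) (pad_mono hxy)
  grad_mono := fun i x hx y hy hxy => by
    rw [partialDeriv_prefixObj h hf.differentiableOn hx,
      partialDeriv_prefixObj h hf.differentiableOn hy]
    exact hf.grad_mono _ (pad_nonneg hx) (pad_nonneg hy) (pad_mono hxy)
  growth := fun x hx => by
    have := hf.growth _ (pad_nonneg (T := T) hx)
    rw [sum_mul_pad h] at this
    simp only [partialDeriv_prefixObj h hf.differentiableOn hx]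
    exact this
  -- A witness for f may need nonzero later variables, so it cannot simply be restricted; positivity
  -- of ∂ᵢf wherever xᵢ > 0 supplies one.
  nondegenerate := fun i => ⟨1, zero_le_one, by
    rw [partialDeriv_prefixObj h hf.differentiableOn zero_le_one]
    exact (hf.partialDeriv_pos (pad_nonneg zero_le_one) (by simp)).ne'⟩

lemma prefixSeq_self {P : Type*} (h : n ≤ n) (σ : Fin n → P) : prefixSeq h σ = σ := rfl

lemma prefixObj_self (h : n ≤ n) (f : (Fin n → ℝ) → ℝ) : prefixObj h f = f := by
  ext x
  simp [prefixObj]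

lemma prefixObj_prefixObj {m : ℕ} (h : n ≤ m) (h' : m ≤ T) (f : (Fin T → ℝ) → ℝ) :
    prefixObj h (prefixObj h' f) = prefixObj (h.trans h') f := by
  ext x
  simp only [prefixObj]
  congr 1
  ext i
  by_cases hi : i.1 < n
  · simp [hi, hi.trans_le h]
  · simp [hi]

end Pad

/-! ### Constraints of a sequence without its last request -/

section PrefixRequests

variable {P : Type*} [DecidableEq P] {T : ℕ}

lemma activeVars_castSucc (σ : Fin (T + 1) → P) (t : Fin T) :
    activeVars σ t.castSucc
      = (activeVars (prefixSeq (Nat.le_succ T) σ) t).map Fin.castSuccEmb := by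
  ext i
  induction i using Fin.lastCases with
  | last => simp [activeVars, Fin.castSucc_ne_last, (Fin.castSucc_lt_last t).le]
  | cast i =>
    simp only [activeVars, Finset.mem_filter, Finset.mem_univ, true_and, Finset.mem_map,
      Fin.coe_castSuccEmb, Fin.castSucc_inj, exists_eq_right, Fin.forall_fin_succ',
      Fin.castSucc_lt_castSucc_iff, Fin.castSucc_le_castSucc_iff]
    have : ¬ Fin.last T ≤ t.castSucc := not_le.2 (Fin.castSucc_lt_last t)
    simp only [this, false_imp_iff, imp_true_iff, and_true]
    rfl

lemma castSucc_mem_activeVars {σ : Fin (T + 1) → P} {t i : Fin T} :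
    i.castSucc ∈ activeVars σ t.castSucc ↔ i ∈ activeVars (prefixSeq (Nat.le_succ T) σ) t := by
  rw [activeVars_castSucc]
  exact Finset.mem_map' Fin.castSuccEmb

lemma last_notMem_activeVars (σ : Fin (T + 1) → P) (t : Fin T) :
    Fin.last T ∉ activeVars σ t.castSucc := by
  simp [activeVars_castSucc, Fin.castSucc_ne_last]

lemma served_pad {k : ℕ} {σ : Fin (T + 1) → P} {t : Fin T} {x : Fin T → ℝ} :
    Served k σ (pad (T + 1) x) t.castSucc ↔ Served k (prefixSeq (Nat.le_succ T) σ) x t := by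
  rw [Served, Served, card_seenPages, card_seenPages, activeVars_castSucc, Finset.card_map,
    Finset.sum_map]
  simp

end PrefixRequests

/-! ### One round of the algorithm -/

section Round

variable {P : Type*} [DecidableEq P] {T : ℕ} {q b : ℝ} {f : (Fin T → ℝ) → ℝ}
  {A : Finset (Fin T)} {x₀ : Fin T → ℝ} {w : ℝ → Fin T → ℝ}

lemma IsFlow.eventually_eq_one (hw : IsFlow f A b x₀ w) :
    ∀ᶠ τ in atTop, 0 ≤ τ ∧ ∀ i ∈ A, w τ i = 1 := by
  refine (eventually_ge_atTop 0).and ((eventually_all_finset A).2 fun i hi => ?_)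
  obtain ⟨c, hc, h⟩ := hw.min_le i hi
  filter_upwards [eventually_ge_atTop c⁻¹] with τ hτ
  have h0 : 0 ≤ τ := (inv_pos.2 hc).le.trans hτ
  refine le_antisymm ((hw.mem τ h0).2 i) ((le_min le_rfl ?_).trans (h τ h0))
  rwa [← inv_le_iff_one_le_mul₀ hc]

lemma exists_first_time {p : ℝ → Prop} (hne : ∃ τ, 0 ≤ τ ∧ p τ)
    (hcl : IsClosed {τ | 0 ≤ τ ∧ p τ}) : ∃ d, 0 ≤ d ∧ p d ∧ ∀ τ, 0 ≤ τ → τ < d → ¬ p τ := by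
  have hb : BddBelow {τ | 0 ≤ τ ∧ p τ} := ⟨0, fun τ hτ => hτ.1⟩
  have hm := hcl.csInf_mem hne hb
  exact ⟨_, hm.1, hm.2, fun τ h0 hlt hp => absurd (csInf_le hb ⟨h0, hp⟩) (not_le.2 hlt)⟩

/-- Once all active variables equal 1 the constraint reads |B(t)| - 1 ≥ |B(t)| - k. The closed set
of times satisfying it therefore has a least element, possibly 0. -/
lemma IsFlow.exists_served (hw : IsFlow f A b x₀ w) {k : ℕ} (hk : 1 ≤ k) {σ : Fin T → P}
    {t : Fin T} (hA : A = activeVars σ t) :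
    ∃ d, 0 ≤ d ∧ Served k σ (w d) t ∧ ∀ τ, 0 ≤ τ → τ < d → ¬ Served k σ (w τ) t := by
  subst hA
  refine exists_first_time ?_ ?_
  · obtain ⟨τ, hτ, h⟩ := hw.eventually_eq_one.exists
    refine ⟨τ, hτ, ?_⟩
    have hk' : (1 : ℝ) ≤ k := by exact_mod_cast hk
    rw [Served, card_seenPages, Finset.sum_congr rfl h, Finset.sum_const, nsmul_eq_mul]
    push_cast
    linarith
  · have hc : ContinuousOn (fun τ => ∑ i ∈ activeVars σ t, w τ i) (Ici 0) :=
      continuousOn_finsetSum _ fun i _ => continuousOn_pi.1 hw.cont i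
    exact hc.preimage_isClosed_of_isClosed isClosed_Ici isClosed_Ici

/-- By monotonicity a variable stays at 1 after its hitting time θ, so the penalty is r times the
time elapsed since θ. -/
lemma IsFlow.exists_penalty (hw : IsFlow f A b x₀ w) (r : ℝ) (i : Fin T) :
    ∃ ζ : ℝ → ℝ, Continuous ζ ∧ ζ 0 = 0 ∧ ∀ τ, 0 < τ →
      HasDerivWithinAt ζ (if i ∈ A ∧ w τ i = 1 then r else 0) (Ici τ) τ := by
  by_cases hi : i ∈ A
  swap
  · exact ⟨fun _ => 0, continuous_const, rfl, fun τ _ => by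
      rw [if_neg fun h => hi h.1]
      exact hasDerivWithinAt_const τ (Ici τ) (0 : ℝ)⟩
  obtain ⟨θ, hθ0, hθ1, hθ⟩ : ∃ θ, 0 ≤ θ ∧ w θ i = 1 ∧ ∀ τ, 0 ≤ τ → τ < θ → ¬ w τ i = 1 := by
    refine exists_first_time ?_ ?_
    · obtain ⟨τ, hτ, h⟩ := hw.eventually_eq_one.exists
      exact ⟨τ, hτ, h i hi⟩
    · exact (continuousOn_pi.1 hw.cont i).preimage_isClosed_of_isClosed isClosed_Ici
        isClosed_singleton
  refine ⟨fun τ => r * max 0 (τ - θ), by fun_prop, by simp [hθ0], fun τ hτ => ?_⟩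
  rcases lt_or_ge τ θ with h | h
  · rw [if_neg fun h' => hθ τ hτ.le h h'.2]
    refine (hasDerivWithinAt_const τ (Ici τ) (0 : ℝ)).congr_of_eventuallyEq_of_mem ?_ self_mem_Ici
    filter_upwards [mem_nhdsWithin_of_mem_nhds (Iio_mem_nhds h)] with u hu
    rw [max_eq_left (sub_nonpos.2 (le_of_lt hu)), mul_zero]
  · have h1 : w τ i = 1 := le_antisymm ((hw.mem τ hτ.le).2 i) (hθ1 ▸ hw.mono hθ0 hτ.le h i)
    rw [if_pos ⟨hi, h1⟩]
    have hd : HasDerivWithinAt (fun u => r * (u - θ)) r (Ici τ) τ := by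
      simpa using (((hasDerivAt_id τ).sub_const θ).const_mul r).hasDerivWithinAt
    refine hd.congr_of_mem (fun u hu => ?_) self_mem_Ici
    rw [max_eq_right (sub_nonneg.2 (h.trans hu))]

lemma IsFlow.hasDerivWithinAt (hw : IsFlow f A b x₀ w) {τ : ℝ} (hτ : 0 < τ) (i : Fin T) :
    HasDerivWithinAt (fun u => w u i)
      (if i ∈ A ∧ w τ i < 1 then (partialDeriv f i (w τ))⁻¹ * (w τ i + b) else 0) (Ici τ) τ := by
  split_ifs with h
  · exact (hw.deriv i h.1 τ hτ h.2).hasDerivWithinAt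
  · refine (hasDerivWithinAt_const τ (Ici τ) (w τ i)).congr_of_mem (fun u hu => ?_) self_mem_Ici
    have hu0 : 0 ≤ u := hτ.le.trans hu
    by_cases hi : i ∈ A
    · have h1 : 1 ≤ w τ i := not_lt.1 fun h' => h ⟨hi, h'⟩
      exact le_antisymm (le_trans ((hw.mem u hu0).2 i) h1) (hw.mono hτ.le hu0 hu i)
    · rw [hw.const i hi u hu0, hw.const i hi τ hτ.le]

end Round

/-! ### Appending a round to an execution -/

section Glue

variable {T : ℕ}

/-- Follows `g` until time `e` and then moves by `h`. -/
noncomputable def glue (e : ℝ) (g : ℝ → Fin T → ℝ) (h : ℝ → Fin (T + 1) → ℝ) :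
    ℝ → Fin (T + 1) → ℝ :=
  fun τ => pad (T + 1) (g (min τ e)) + h (max 0 (τ - e))

variable {e : ℝ} {g : ℝ → Fin T → ℝ} {h : ℝ → Fin (T + 1) → ℝ}

lemma glue_of_le (h0 : h 0 = 0) {τ : ℝ} (hτ : τ ≤ e) : glue e g h τ = pad (T + 1) (g τ) := by
  rw [glue, min_eq_left hτ, max_eq_left (sub_nonpos.2 hτ), h0, add_zero]

lemma glue_of_ge {τ : ℝ} (hτ : e ≤ τ) : glue e g h τ = pad (T + 1) (g e) + h (τ - e) := by
  rw [glue, min_eq_right hτ, max_eq_right (sub_nonneg.2 hτ)]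

/-- Clamping the time arguments writes the glued curve as a sum of two continuous curves, so no
pasting at e is needed. -/
lemma continuousOn_glue (he : 0 ≤ e) (hg : ContinuousOn g (Icc 0 e))
    (hh : ContinuousOn h (Ici 0)) (c : ℝ) : ContinuousOn (glue e g h) (Icc 0 c) := by
  refine ContinuousOn.add ?_ ?_
  · refine (padL T (T + 1)).continuous.comp_continuousOn (hg.comp (by fun_prop) ?_)
    exact fun τ hτ => ⟨le_min hτ.1 he, min_le_right _ _⟩
  · exact hh.comp (by fun_prop) fun τ _ => mem_Ici.2 (le_max_left _ _)

lemma hasDerivWithinAt_glue_of_lt (h0 : h 0 = 0) {τ : ℝ} (hτ : τ < e) {v : Fin T → ℝ}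
    (hg : ∀ i, HasDerivWithinAt (fun u => g u i) (v i) (Ici τ) τ) (i : Fin (T + 1)) :
    HasDerivWithinAt (fun u => glue e g h u i) (pad (T + 1) v i) (Ici τ) τ := by
  have h1 : HasDerivWithinAt (fun u => pad (T + 1) (g u) i) (pad (T + 1) v i) (Ici τ) τ := by
    induction i using Fin.lastCases with
    | last => simpa using hasDerivWithinAt_const τ (Ici τ) (0 : ℝ)
    | cast i => simpa using hg i
  refine h1.congr_of_eventuallyEq_of_mem ?_ self_mem_Ici
  filter_upwards [mem_nhdsWithin_of_mem_nhds (Iio_mem_nhds hτ)] with u hu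
  rw [glue_of_le h0 (le_of_lt hu)]

lemma hasDerivWithinAt_glue_of_gt {τ : ℝ} (hτ : e < τ) {v : ℝ} {i : Fin (T + 1)}
    (hh : HasDerivWithinAt (fun u => h u i) v (Ici (τ - e)) (τ - e)) :
    HasDerivWithinAt (fun u => glue e g h u i) v (Ici τ) τ := by
  have h1 : HasDerivWithinAt (fun u => h (u - e) i) v (Ici τ) τ := by
    have := hh.comp τ (((hasDerivAt_id τ).sub_const e).hasDerivWithinAt (s := Ici τ))
      fun u hu => sub_le_sub_right hu e
    rwa [mul_one] at this
  refine (h1.const_add (pad (T + 1) (g e) i)).congr_of_mem (fun u hu => ?_) self_mem_Ici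
  rw [glue_of_ge (hτ.le.trans hu), Pi.add_apply]

end Glue

/-! ### Existence of one more round -/

section Extension

variable {P : Type*} [DecidableEq P] {T k : ℕ} {q : ℝ}

theorem IsObjectiveRun.exists_extends {σ : Fin (T + 1) → P} {f : (Fin (T + 1) → ℝ) → ℝ}
    (hf : IsObjective q f) (hk : 1 ≤ k) {R : Execution T}
    (hR : IsObjectiveRun k q (prefixSeq (Nat.le_succ T) σ) (prefixObj (Nat.le_succ T) f) R) :
    ∃ R', IsObjectiveRun k q σ f R' ∧ Extends (Nat.le_succ T) R' R := by
  obtain ⟨e, he⟩ : ∃ e, e = R.time (Fin.last T) := ⟨_, rfl⟩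
  have he0 : 0 ≤ e := he ▸ hR.time_nonneg _
  have hxR : ∀ τ ∈ Icc 0 e, R.x τ ∈ Icc (0 : Fin T → ℝ) 1 := fun τ hτ =>
    ⟨fun i => (hR.x_mem_Icc hk (he ▸ hτ) i).1, fun i => (hR.x_mem_Icc hk (he ▸ hτ) i).2⟩
  have hx₀ : pad (T + 1) (R.x e) ∈ Icc (0 : Fin (T + 1) → ℝ) 1 := by
    have := hxR e (right_mem_Icc.2 he0)
    refine ⟨pad_nonneg this.1, fun i => ?_⟩
    induction i using Fin.lastCases with
    | last => simp
    | cast i => simpa using this.2 i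
  obtain ⟨w, hw⟩ := hf.exists_isFlow (activeVars σ (Fin.last T))
    (show (0 : ℝ) < 1 / k by positivity) hx₀
  obtain ⟨d, hd0, hd, hnd⟩ := hw.exists_served hk rfl
  choose ζ hζc hζ0 hζd using hw.exists_penalty (dualRate k q)
  -- Gluing adds a displacement that vanishes at 0, hence the flow minus its initial value.
  obtain ⟨X, hX⟩ : ∃ X : ℝ → Fin (T + 1) → ℝ, X = fun u => w u - w 0 := ⟨_, rfl⟩
  obtain ⟨Y, hY⟩ : ∃ Y : ℝ → Fin (T + 1) → ℝ,
    Y = fun u i => if i = Fin.last T then dualRate k q * u else 0 := ⟨_, rfl⟩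
  obtain ⟨Z, hZ⟩ : ∃ Z : ℝ → Fin (T + 1) → ℝ, Z = fun u i => ζ i u := ⟨_, rfl⟩
  have hX0 : X 0 = 0 := by rw [hX]; exact sub_self _
  have hY0 : Y 0 = 0 := by rw [hY]; ext i; simp
  have hZ0 : Z 0 = 0 := by rw [hZ]; ext i; exact hζ0 i
  have hxe : ∀ τ, e ≤ τ → glue e R.x X τ = w (τ - e) := fun τ hτ => by
    rw [glue_of_ge hτ, hX, hw.init, add_sub_cancel]
  have htime : ∀ t : Fin T, ∀ τ ∈ Ioo (R.time t.castSucc) (R.time t.succ), τ ∈ Icc 0 e ∧ τ < e :=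
    fun t τ hτ => by
      have h1 := hR.time_nonneg t.castSucc
      have h2 := he ▸ hR.monotone_time (Fin.le_last t.succ)
      exact ⟨⟨h1.trans hτ.1.le, hτ.2.le.trans h2⟩, hτ.2.trans_le h2⟩
  have hpd : ∀ τ ∈ Icc 0 e, ∀ i, partialDeriv (prefixObj (Nat.le_succ T) f) i (R.x τ)
      = partialDeriv f i.castSucc (pad (T + 1) (R.x τ)) := fun τ hτ i =>
    partialDeriv_prefixObj (Nat.le_succ T) hf.differentiableOn (hxR τ hτ).1 i
  obtain ⟨R', hR'⟩ : ∃ R' : Execution (T + 1), R' =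
    ⟨Fin.snoc (α := fun _ => ℝ) R.time (e + d), glue e R.x X, glue e R.y Y, glue e R.z Z⟩ :=
    ⟨_, rfl⟩
  have ht1 : ∀ m : Fin (T + 1), R'.time m.castSucc = R.time m := fun m => by
    rw [hR']; exact Fin.snoc_castSucc (α := fun _ => ℝ) _ _ _
  have ht2 : R'.time (Fin.last (T + 1)) = e + d := by
    rw [hR']; exact Fin.snoc_last (α := fun _ => ℝ) _ _
  have hx' : R'.x = glue e R.x X := by rw [hR']
  have hy' : R'.y = glue e R.y Y := by rw [hR']
  have hz' : R'.z = glue e R.z Z := by rw [hR']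
  refine ⟨R', ?_, ?_, ?_⟩
  rotate_left
  · exact ht1
  · intro τ hτ i
    rw [← he] at hτ
    rw [hx', hy', hz', glue_of_le hX0 hτ.2, glue_of_le hY0 hτ.2, glue_of_le hZ0 hτ.2]
    simp
  constructor
  · rw [← Fin.castSucc_zero, ht1, hR.time_zero]
  · intro t
    rw [ht1]
    induction t using Fin.lastCases with
    | last => rw [Fin.succ_last, ht2, ← he]; linarith
    | cast t => rw [Fin.succ_castSucc, ht1]; exact hR.time_le t
  · rw [hx', glue_of_le hX0 he0, hR.x_zero, pad_zero]
  · rw [hy', glue_of_le hY0 he0, hR.y_zero, pad_zero]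
  · rw [hz', glue_of_le hZ0 he0, hR.z_zero, pad_zero]
  · rw [hx']
    exact continuousOn_glue he0 (he ▸ hR.x_cont) (by rw [hX]; exact hw.cont.sub continuousOn_const) _
  · rw [hy']
    refine continuousOn_glue he0 (he ▸ hR.y_cont) (Continuous.continuousOn ?_) _
    rw [hY]
    refine continuous_pi fun i => ?_
    split_ifs <;> fun_prop
  · rw [hz']
    refine continuousOn_glue he0 (he ▸ hR.z_cont) (Continuous.continuousOn ?_) _
    rw [hZ]
    exact continuous_pi hζc
  · intro t τ hτ i hi h1
    rw [ht1] at hτ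
    induction t using Fin.lastCases with
    | last =>
      rw [← he] at hτ
      rw [hx', hxe τ hτ.1.le]
      exact inv_pos.2 (hw.pos i hi _ (sub_pos.2 hτ.1))
    | cast t =>
      rw [Fin.succ_castSucc, ht1] at hτ
      obtain ⟨hτ', hτe⟩ := htime t τ hτ
      rw [hx', glue_of_le hX0 hτe.le] at h1 ⊢
      induction i using Fin.lastCases with
      | last => exact absurd hi (last_notMem_activeVars σ t)
      | cast i =>
        have := hR.rate_pos t τ hτ i (castSucc_mem_activeVars.1 hi) (by simpa using h1)
        rwa [hpd τ hτ'] at this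
  · intro t τ hτ
    rw [ht1] at hτ
    rw [hy']
    induction t using Fin.lastCases with
    | last =>
      rw [← he] at hτ
      intro i
      refine hasDerivWithinAt_glue_of_gt hτ.1 ?_
      rw [hY]
      dsimp only
      split_ifs
      · simpa using ((hasDerivAt_id (τ - e)).const_mul (dualRate k q)).hasDerivWithinAt
      · exact hasDerivWithinAt_const _ _ _
    | cast t =>
      rw [Fin.succ_castSucc, ht1] at hτ
      intro i
      convert hasDerivWithinAt_glue_of_lt hY0 (htime t τ hτ).2 (hR.y_deriv t τ hτ) i using 1
      induction i using Fin.lastCases with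
      | last => simp [(Fin.castSucc_ne_last t).symm]
      | cast i => simp
  · intro t τ hτ
    rw [ht1] at hτ
    rw [hx']
    induction t using Fin.lastCases with
    | last =>
      rw [← he] at hτ
      intro i
      refine hasDerivWithinAt_glue_of_gt hτ.1 ?_
      rw [hxe τ hτ.1.le, hX]
      exact (hw.hasDerivWithinAt (sub_pos.2 hτ.1) i).sub_const _
    | cast t =>
      rw [Fin.succ_castSucc, ht1] at hτ
      obtain ⟨hτ', hτe⟩ := htime t τ hτ
      intro i
      convert hasDerivWithinAt_glue_of_lt hX0 hτe (hR.x_deriv t τ hτ) i using 1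
      rw [glue_of_le hX0 hτe.le]
      induction i using Fin.lastCases with
      | last => simp [last_notMem_activeVars]
      | cast i => simp [castSucc_mem_activeVars, hpd τ hτ']
  · intro t τ hτ
    rw [ht1] at hτ
    rw [hx', hz']
    induction t using Fin.lastCases with
    | last =>
      rw [← he] at hτ
      intro i
      refine hasDerivWithinAt_glue_of_gt hτ.1 ?_
      rw [hxe τ hτ.1.le, hZ]
      exact hζd i _ (sub_pos.2 hτ.1)
    | cast t =>
      rw [Fin.succ_castSucc, ht1] at hτ
      obtain ⟨hτ', hτe⟩ := htime t τ hτ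
      intro i
      convert hasDerivWithinAt_glue_of_lt hZ0 hτe (hR.z_deriv t τ hτ) i using 1
      rw [glue_of_le hX0 hτe.le]
      induction i using Fin.lastCases with
      | last => simp [last_notMem_activeVars]
      | cast i => simp [castSucc_mem_activeVars]
  · intro t τ hτ
    rw [ht1] at hτ
    rw [hx']
    induction t using Fin.lastCases with
    | last =>
      rw [← he, Fin.succ_last, ht2] at hτ
      rw [hxe τ hτ.1]
      exact hnd _ (sub_nonneg.2 hτ.1) (by linarith [hτ.2])
    | cast t =>
      rw [Fin.succ_castSucc, ht1] at hτ
      have h2 := he ▸ hR.monotone_time (Fin.le_last t.succ)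
      rw [glue_of_le hX0 (hτ.2.le.trans h2), served_pad]
      exact hR.not_served t τ hτ
  · intro t
    rw [hx']
    induction t using Fin.lastCases with
    | last =>
      rw [Fin.succ_last, ht2, hxe _ (by linarith), add_sub_cancel_left]
      exact hd
    | cast t =>
      have h2 := he ▸ hR.monotone_time (Fin.le_last t.succ)
      rw [Fin.succ_castSucc, ht1, glue_of_le hX0 h2, served_pad]
      exact hR.served t

end Extension

/-! ### The online algorithm -/

section Online

variable {P : Type*} [DecidableEq P] (k : ℕ) (q : ℝ)

instance (T : ℕ) : Nonempty (Execution T) := ⟨⟨0, 0, 0, 0⟩⟩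

/-- The online algorithm: it extends its own execution on the sequence without the last request. -/
noncomputable def onlineAlg :
    (T : ℕ) → (Fin T → P) → ((Fin T → ℝ) → ℝ) → Execution T
  | 0, _, _ => ⟨0, 0, 0, 0⟩
  | T + 1, σ, f =>
    Classical.epsilon fun R' => IsObjectiveRun k q σ f R' ∧
      Extends (Nat.le_succ T) R'
        (onlineAlg T (prefixSeq (Nat.le_succ T) σ) (prefixObj (Nat.le_succ T) f))

variable {k q}

lemma Extends.refl {T : ℕ} (R : Execution T) : Extends le_rfl R R :=
  ⟨fun _ => rfl, fun _ _ _ => ⟨rfl, rfl, rfl⟩⟩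

/-- The intermediate execution is controlled only up to its own final time, which must not precede
that of the shortest one. -/
lemma Extends.trans {n m T : ℕ} {h : n ≤ m} {h' : m ≤ T} {R : Execution n} {R' : Execution m}
    {R'' : Execution T} (h1 : Extends h' R'' R') (h2 : Extends h R' R)
    (hle : R.time (Fin.last n) ≤ R'.time (Fin.last m)) : Extends (h.trans h') R'' R := by
  refine ⟨fun j => (h1.1 _).trans (h2.1 j), fun τ hτ i => ?_⟩
  obtain ⟨a1, a2, a3⟩ := h1.2 τ ⟨hτ.1, hτ.2.trans hle⟩ (Fin.castLE h i)
  obtain ⟨b1, b2, b3⟩ := h2.2 τ hτ i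
  exact ⟨a1.trans b1, a2.trans b2, a3.trans b3⟩

lemma isObjectiveRun_onlineAlg (hk : 1 ≤ k) {T : ℕ} (σ : Fin T → P) {f : (Fin T → ℝ) → ℝ}
    (hf : IsObjective q f) : IsObjectiveRun k q σ f (onlineAlg k q T σ f) := by
  induction T with
  | zero =>
    have hsub : ∀ g : ℝ → Fin 0 → ℝ, ContinuousOn g (Icc 0 0) := fun g => by
      rw [Icc_self]; exact continuousOn_singleton _ _
    exact ⟨rfl, fun t => t.elim0, rfl, rfl, rfl, hsub _, hsub _, hsub _, fun t => t.elim0,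
      fun t => t.elim0, fun t => t.elim0, fun t => t.elim0, fun t => t.elim0, fun t => t.elim0⟩
  | succ T ih =>
    exact (Classical.epsilon_spec
      ((ih (prefixSeq (Nat.le_succ T) σ) (hf.prefixObj (Nat.le_succ T))).exists_extends hf hk)).1

lemma extends_onlineAlg (hk : 1 ≤ k) {T : ℕ} (σ : Fin T → P) {f : (Fin T → ℝ) → ℝ}
    (hf : IsObjective q f) {n : ℕ} (h : n ≤ T) :
    Extends h (onlineAlg k q T σ f) (onlineAlg k q n (prefixSeq h σ) (prefixObj h f)) := by
  induction T with
  | zero =>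
    obtain rfl := Nat.le_zero.1 h
    rw [prefixSeq_self, prefixObj_self]
    exact Extends.refl _
  | succ T ih =>
    rcases Nat.lt_or_eq_of_le h with hn | rfl
    · have hn' : n ≤ T := Nat.lt_succ_iff.1 hn
      have hf' := hf.prefixObj (Nat.le_succ T)
      have hrun := isObjectiveRun_onlineAlg hk (prefixSeq (Nat.le_succ T) σ) hf'
      have h1 := (Classical.epsilon_spec (hrun.exists_extends hf hk)).2
      have h2 := ih (prefixSeq (Nat.le_succ T) σ) hf' hn'
      rw [prefixObj_prefixObj] at h2
      refine Extends.trans h1 h2 ?_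
      exact (h2.1 _).symm.le.trans (hrun.monotone_time (Fin.le_last _))
    · rw [prefixSeq_self, prefixObj_self]
      exact Extends.refl _

end Online

end Paging

theorem mainTheorem1 {P : Type*} [DecidableEq P] (k : ℕ) (hk : 1 ≤ k) (q : ℝ) (hq : 1 ≤ q) :
    (∀ (T : ℕ) (σ : Fin T → P) (f : (Fin T → ℝ) → ℝ), Paging.IsObjective q f →
      ∀ R : Paging.Execution T, Paging.IsObjectiveRun k q σ f R →
        MonotoneOn R.x (Set.Icc 0 (R.time (Fin.last T))) ∧
        Paging.Feasible k σ R.final ∧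
        ∀ x : Fin T → ℝ, Paging.Feasible k σ x →
          f R.final ≤ (2 * q * Real.log ((k : ℝ) + 1)) ^ q * f x) ∧
    ∃ alg : (T : ℕ) → (Fin T → P) → ((Fin T → ℝ) → ℝ) → Paging.Execution T,
      ∀ (T : ℕ) (σ : Fin T → P) (f : (Fin T → ℝ) → ℝ), Paging.IsObjective q f →
        Paging.IsObjectiveRun k q σ f (alg T σ f) ∧
        ∀ (n : ℕ) (h : n ≤ T),
          Paging.Extends h (alg T σ f) (alg n (Paging.prefixSeq h σ) (Paging.prefixObj h f)) := by
  refine ⟨fun T σ f hf R hR => ⟨hR.monotoneOn_x hk, hR.feasible_final hk,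
    fun x hx => hR.competitive hf hk hq hx⟩, Paging.onlineAlg k q, fun T σ f hf => ?_⟩
  exact ⟨Paging.isObjectiveRun_onlineAlg hk σ hf, fun n h => Paging.extends_onlineAlg hk σ hf h⟩
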